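/- **Conventions.** For a commutative $\mathbb{C}$-algebra $R$ with a $\mathbb{C}$-linear derivation $\partial$, let $\mathrm{PsiDO}(R,\partial)_{\le 0}$ be the algebra of formal series $\sum_{j\ge 0} a_j D_\partial^{-j}$ ($a_j\in R$) with product $$\Big(\sum_i a_iD_\partial^{-i}\Big)\Big(\sum_j b_jD_\partial^{-j}\Big)=\sum_{i,j,m\ge 0}\binom{-i}{m}a_i\,\partial^m(b_j)\,D_\partial^{-(i+j+m)},$$ filtered by the subspaces $\mathrm{PsiDO}(R,\partial)_{\le -n}$ of series with $a_j=0$ for $j<n$. If $\partial=g\partial'$ with $g\in R^\times$, the substitution $D_\partial=gD_{\partial'}$ identifies $\mathrm{PsiDO}(R,\partial)_{\le 0}$ with $\mathrm{PsiDO}(R,\partial')_{\le 0}$. Let $C$ be a smooth projective connected complex curve and $X$ a nonzero rational vector field on $C$, i.e. a nonzero derivation of $\mathbb{C}(C)$. Put $B_X^{C,\mathrm{rat}}=\mathrm{PsiDO}(\mathbb{C}(C),X)_{\le 0}$. For $P\in C$ and a formal local coordinate $z_P$ at $P$, write $X=X(z_P)\,\partial/\partial z_P$; Laurent expansion at $P$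 and the substitution $D_X=X(z_P)D_{\partial/\partial z_P}$ give $L_P^{z_P}:B_X^{C,\mathrm{rat}}\to\mathrm{PsiDO}(\mathbb{C}((z_P)),\partial/\partial z_P)_{\le 0}$. For an effective divisor $D=\sum_P\delta_P P$, let $$B_X^{(C,D)}=\Big\{b\in B_X^{C,\mathrm{rat}} : L_P^{z_P}(b)\in \mathrm{PsiDO}(\mathbb{C}[[z_P]],z_P^{\delta_P}\partial/\partial z_P)_{\le 0}\ \text{ for all } P\in C\Big\},$$ with the induced filtration, and $B_X^{(C)}=B_X^{(C,0)}$. Classically, let $A^{(C,D)}=\bigoplus_{i\ge 0}H^0(C,K(D)^{\otimes i})$ and $A^{(C)}=A^{(C,0)}$. Let $\alpha$ be the rational differential with $\langle X,\alpha\rangle=1$, and let $\lambda^{(i)}$ send the class of $\sum_{j\ge i}a_jD_X^{-j}$ modulo operators of degree $\le -i-1$ to the rational $i$-differential $a_i\alpha^i$. **Proposition.** Let $C,C'$ be smooth projective connected complex curves, $\varphi:C\to C'$ a possibly ramified covering (a finite surjective morphism), $X'$ a nonzero rational vector field on $C'$, $\alpha'$ the rational differential with $\langle X',\alpha'\rangle=1$,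 and $X$ the rational vector field on $C$ with $\langle X,\varphi^*\alpha'\rangle=1$. Choose any families of formal local coordinates at the points of $C$ and of $C'$. Then $$\varphi^*_{\mathrm{rat}}:B_{X'}^{C',\mathrm{rat}}\to B_X^{C,\mathrm{rat}},\qquad \sum_{j\ge0}a_jD_{X'}^{-j}\mapsto\sum_{j\ge0}\varphi^*(a_j)D_X^{-j},$$ is a morphism of complete filtered algebras. It restricts to morphisms of complete filtered algebras $$B_{X'}^{(C')}\to B_X^{(C)}\qquad\text{and}\qquad B_{X'}^{(C',D')}\to B_X^{(C,D)}$$ for every effective divisor $D'=\sum_{P'}\delta'_{P'}P'$ on $C'$, where $$D=\varphi^{-1}(D')=\sum_{P\in C}\max\big(0,\ \delta'_{\varphi(P)}\nu_P+1-\nu_P\big)\,P$$ and $\nu_P$ is the ramification index of $\varphi$ at $P$. These morphisms quantize the classical pullbacks of $i$-differentials $\varphi^*_{\mathrm{class}}:A^{(C')}\to A^{(C)}$ and $\varphi^*_{\mathrm{class}}:A^{(C',D')}\to A^{(C,D)}$: the maps $\lambda^{(i)}$ send the $i$-th graded pieces of the filtered algebras to the degree $i$ parts of the corresponding classical algebras,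 $\varphi^*_{\mathrm{class}}$ maps each classical algebra for $C'$ into the corresponding one for $C$, and the associated graded of each morphism corresponds to $\varphi^*_{\mathrm{class}}$ under the maps $\lambda^{(i)}$. -/

import Mathlib

open AlgebraicGeometry CategoryTheory
open scoped LaurentSeries PowerSeries KaehlerDifferential

attribute [-instance] HahnSeries.powerSeriesAlgebra

section PseudodifferentialOperators

open Finset

/-- `PsiDO ∂` is the ring `PsiDO(R, ∂)_{≤ 0}` of formal pseudodifferential operators of degree
`≤ 0` over the differential ring `(R, ∂)`: the element `a` stands for the formal series
`∑_{j ≥ 0} (a.coeff j) D_∂^{-j}`. -/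
@[ext]
structure PsiDO {k R : Type*} [CommRing k] [CommRing R] [Algebra k R]
    (d : Derivation k R R) where
  coeff : ℕ → R

namespace PsiDO

variable {k R : Type*} [CommRing k] [CommRing R] [Algebra k R] {d : Derivation k R R}

instance : Zero (PsiDO d) := ⟨⟨fun _ => 0⟩⟩
instance : One (PsiDO d) := ⟨⟨fun n => if n = 0 then 1 else 0⟩⟩
instance : Add (PsiDO d) := ⟨fun a b => ⟨fun n => a.coeff n + b.coeff n⟩⟩
instance : Neg (PsiDO d) := ⟨fun a => ⟨fun n => -a.coeff n⟩⟩
instance : Sub (PsiDO d) := ⟨fun a b => ⟨fun n => a.coeff n - b.coeff n⟩⟩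
instance {M : Type*} [SMul M R] : SMul M (PsiDO d) := ⟨fun c a => ⟨fun n => c • a.coeff n⟩⟩

/-- The product: `(∑ a_i D^{-i}) (∑ b_j D^{-j}) = ∑ binom(-i, m) a_i ∂^m(b_j) D^{-(i+j+m)}`. -/
instance : Mul (PsiDO d) := ⟨fun a b => ⟨fun n =>
  ∑ p ∈ antidiagonal n, ∑ q ∈ antidiagonal p.2,
    Ring.choose (-(p.1 : ℤ)) q.2 • (a.coeff p.1 * d^[q.2] (b.coeff q.1))⟩⟩

theorem coeff_zero (n : ℕ) : (0 : PsiDO d).coeff n = 0 := rfl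
theorem coeff_one (n : ℕ) : (1 : PsiDO d).coeff n = if n = 0 then 1 else 0 := rfl
theorem coeff_add (a b : PsiDO d) (n : ℕ) : (a + b).coeff n = a.coeff n + b.coeff n := rfl
theorem coeff_neg (a : PsiDO d) (n : ℕ) : (-a).coeff n = -a.coeff n := rfl
theorem coeff_sub (a b : PsiDO d) (n : ℕ) : (a - b).coeff n = a.coeff n - b.coeff n := rfl
theorem coeff_smul {M : Type*} [SMul M R] (c : M) (a : PsiDO d) (n : ℕ) :
    (c • a).coeff n = c • a.coeff n := rfl
theorem coeff_mul (a b : PsiDO d) (n : ℕ) : (a * b).coeff n =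
    ∑ p ∈ antidiagonal n, ∑ q ∈ antidiagonal p.2,
      Ring.choose (-(p.1 : ℤ)) q.2 • (a.coeff p.1 * d^[q.2] (b.coeff q.1)) := rfl

theorem coeff_injective : Function.Injective (coeff : PsiDO d → ℕ → R) :=
  fun _ _ h => PsiDO.ext h

instance : AddCommGroup (PsiDO d) :=
  coeff_injective.addCommGroup _ rfl (fun _ _ => rfl) (fun _ => rfl) (fun _ _ => rfl)
    (fun _ _ => rfl) (fun _ _ => rfl)

/-- Taking coefficients, as an additive map. -/
def coeffHom (d : Derivation k R R) : PsiDO d →+ (ℕ → R) where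
  toFun := coeff
  map_zero' := rfl
  map_add' _ _ := rfl

instance {S : Type*} [Semiring S] [Module S R] : Module S (PsiDO d) :=
  coeff_injective.module S (coeffHom d) (fun _ _ => rfl)

/-- `D^{-i} b` at order `n`: the auxiliary family computing left multiplication by `D^{-i}`. -/
def shiftCoeff (d : Derivation k R R) (b : ℕ → R) (i n : ℕ) : R :=
  ∑ q ∈ antidiagonal n, Ring.choose (-(i : ℤ)) q.2 • d^[q.2] (b q.1)

theorem shiftCoeff_zero (b : ℕ → R) (n : ℕ) : shiftCoeff d b 0 n = b n := by
  unfold shiftCoeff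
  rw [Finset.sum_eq_single (n, 0)]
  · simp
  · rintro ⟨x, y⟩ hxy hne
    have hy : y ≠ 0 := by
      rintro rfl
      simp at hxy
      exact hne (by simp [hxy])
    obtain ⟨y, rfl⟩ := Nat.exists_eq_succ_of_ne_zero hy
    simp [Ring.choose_zero_succ]
  · simp

theorem shiftCoeff_succ_zero (b : ℕ → R) (i : ℕ) :
    shiftCoeff d b (i + 1) 0 = shiftCoeff d b i 0 := by
  simp [shiftCoeff]

theorem shiftCoeff_succ_succ (b : ℕ → R) (i n : ℕ) :
    shiftCoeff d b (i + 1) (n + 1) = shiftCoeff d b i (n + 1) - d (shiftCoeff d b (i + 1) n) := by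
  unfold shiftCoeff
  rw [Finset.Nat.sum_antidiagonal_succ', Finset.Nat.sum_antidiagonal_succ' (n := n)]
  simp only [map_sum, Derivation.map_smul_of_tower, ← Function.iterate_succ_apply' (⇑d)]
  simp only [Ring.choose_zero_right]
  rw [eq_sub_iff_add_eq, add_assoc, ← Finset.sum_add_distrib]
  congr 1
  refine Finset.sum_congr rfl fun q _ => ?_
  rw [← add_smul]
  congr 1
  have := Ring.choose_succ_succ (-((i + 1 : ℕ) : ℤ)) q.2
  have e : (-((i + 1 : ℕ) : ℤ)) + 1 = -(i : ℤ) := by push_cast; ring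
  rw [e] at this
  rw [this]; ring

theorem coeff_mul_eq (a b : PsiDO d) (n : ℕ) : (a * b).coeff n =
    ∑ p ∈ antidiagonal n, a.coeff p.1 * shiftCoeff d b.coeff p.1 p.2 := by
  rw [coeff_mul]
  refine Finset.sum_congr rfl fun p _ => ?_
  rw [shiftCoeff, Finset.mul_sum]
  exact Finset.sum_congr rfl fun q _ => by rw [mul_smul_comm]

theorem shiftCoeff_add (a b : ℕ → R) (i n : ℕ) :
    shiftCoeff d (a + b) i n = shiftCoeff d a i n + shiftCoeff d b i n := by
  simp [shiftCoeff, smul_add, Finset.sum_add_distrib, iterate_map_add]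

theorem shiftCoeff_smul (c : k) (b : ℕ → R) (i n : ℕ) :
    shiftCoeff d (c • b) i n = c • shiftCoeff d b i n := by
  have h : ∀ m (x : R), d^[m] (c • x) = c • d^[m] x := fun m => by
    induction m with
    | zero => simp
    | succ m ih => intro x; simp [ih]
  simp [shiftCoeff, Finset.smul_sum, h]

theorem shiftCoeff_congr {a b : ℕ → R} {n : ℕ} (h : ∀ j ≤ n, a j = b j) (i : ℕ) :
    shiftCoeff d a i n = shiftCoeff d b i n := by
  refine Finset.sum_congr rfl fun q hq => ?_
  rw [h _ (HasAntidiagonal.antidiagonal.fst_le hq)]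

theorem mul_congr {a a' b b' : PsiDO d} {n : ℕ} (ha : ∀ j ≤ n, a.coeff j = a'.coeff j)
    (hb : ∀ j ≤ n, b.coeff j = b'.coeff j) : (a * b).coeff n = (a' * b').coeff n := by
  rw [coeff_mul_eq, coeff_mul_eq]
  refine Finset.sum_congr rfl fun p hp => ?_
  rw [ha _ (HasAntidiagonal.antidiagonal.fst_le hp),
    shiftCoeff_congr fun j hj => hb j (hj.trans (HasAntidiagonal.antidiagonal.snd_le hp))]

/-- The operator `D^{-1}`. -/
def xi (d : Derivation k R R) : PsiDO d := ⟨fun n => if n = 1 then 1 else 0⟩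

/-- Operators of order zero: the function `r`. -/
def const (d : Derivation k R R) (r : R) : PsiDO d := ⟨fun n => if n = 0 then r else 0⟩

theorem const_mul_coeff (r : R) (b : PsiDO d) (n : ℕ) :
    (const d r * b).coeff n = r * b.coeff n := by
  rw [coeff_mul_eq, Finset.sum_eq_single (0, n)]
  · simp [const, shiftCoeff_zero]
  · rintro ⟨x, y⟩ hxy hne
    have hx : x ≠ 0 := by
      rintro rfl
      simp at hxy
      exact hne (by simp [hxy])
    simp [const, hx]
  · simp

theorem xi_mul_coeff_zero (b : PsiDO d) : (xi d * b).coeff 0 = 0 := by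
  simp [coeff_mul_eq, xi]

theorem xi_mul_coeff_succ' (b : PsiDO d) (n : ℕ) :
    (xi d * b).coeff (n + 1) = shiftCoeff d b.coeff 1 n := by
  rw [coeff_mul_eq, Finset.sum_eq_single (1, n)]
  · simp [xi]
  · rintro ⟨x, y⟩ hxy hne
    have hx : x ≠ 1 := by
      rintro rfl
      simp at hxy
      exact hne (by simp; omega)
    simp [xi, hx]
  · simp [add_comm]

theorem xi_mul_coeff_succ (b : PsiDO d) (n : ℕ) :
    (xi d * b).coeff (n + 1) = b.coeff n - d ((xi d * b).coeff n) := by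
  rw [xi_mul_coeff_succ']
  cases n with
  | zero => simp [xi_mul_coeff_zero, shiftCoeff_succ_zero, shiftCoeff_zero]
  | succ n => rw [xi_mul_coeff_succ', shiftCoeff_succ_succ, shiftCoeff_zero]

theorem eq_xi_mul {w y : PsiDO d} (h0 : w.coeff 0 = 0)
    (h : ∀ n, w.coeff (n + 1) = y.coeff n - d (w.coeff n)) : w = xi d * y := by
  ext n
  induction n with
  | zero => rw [h0, xi_mul_coeff_zero]
  | succ n ih => rw [h, xi_mul_coeff_succ, ih]

theorem shiftCoeff_sub (b : ℕ → R) (i n : ℕ) : shiftCoeff d b i n - shiftCoeff d b (i + 1) n =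
    if n = 0 then 0 else d (shiftCoeff d b (i + 1) (n - 1)) := by
  cases n with
  | zero => simp [shiftCoeff_succ_zero]
  | succ n => simp [shiftCoeff_succ_succ]

theorem xi_mul_assoc (y z : PsiDO d) : (xi d * y) * z = xi d * (y * z) := by
  refine eq_xi_mul ?_ fun n => ?_
  · simp [coeff_mul_eq, xi]
  · set w := xi d * y with hw
    set S := shiftCoeff d z.coeff with hS
    have h1 : (w * z).coeff (n + 1) =
        ∑ p ∈ antidiagonal n, w.coeff (p.1 + 1) * S (p.1 + 1) p.2 := by
      rw [coeff_mul_eq, Finset.Nat.sum_antidiagonal_succ]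
      simp [hw, xi_mul_coeff_zero, hS]
    have key : ∑ p ∈ antidiagonal n, w.coeff p.1 * d (S p.1 p.2) =
        ∑ p ∈ antidiagonal n, w.coeff (p.1 + 1) * (S p.1 p.2 - S (p.1 + 1) p.2) := by
      cases n with
      | zero => simp [hw, xi_mul_coeff_zero, hS, shiftCoeff_sub]
      | succ n =>
        rw [Finset.Nat.sum_antidiagonal_succ, Finset.Nat.sum_antidiagonal_succ']
        simp [hw, xi_mul_coeff_zero, hS, shiftCoeff_sub]
    have h2 : d ((w * z).coeff n) = ∑ p ∈ antidiagonal n,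
        (S p.1 p.2 * d (w.coeff p.1) + w.coeff p.1 * d (S p.1 p.2)) := by
      rw [coeff_mul_eq, map_sum]
      refine Finset.sum_congr rfl fun p _ => ?_
      rw [Derivation.leibniz]
      simp only [smul_eq_mul, hS]
      ring
    rw [h1, h2, Finset.sum_add_distrib, key, coeff_mul_eq, ← Finset.sum_add_distrib,
      ← Finset.sum_sub_distrib]
    refine Finset.sum_congr rfl fun p _ => ?_
    rw [hw, xi_mul_coeff_succ]
    ring

theorem iterate_xi_coeff (b : PsiDO d) (i n : ℕ) : ((xi d * ·)^[i] b).coeff n =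
    if i ≤ n then shiftCoeff d b.coeff i (n - i) else 0 := by
  induction i generalizing n with
  | zero => simp [shiftCoeff_zero]
  | succ i ih =>
    rw [Function.iterate_succ_apply']
    induction n with
    | zero => simp [xi_mul_coeff_zero]
    | succ n ihn =>
      rw [xi_mul_coeff_succ, ihn, ih]
      rcases lt_trichotomy i n with h | h | h
      · obtain ⟨m, rfl⟩ := Nat.exists_eq_add_of_lt h
        have e1 : i + m + 1 - i = m + 1 := by omega
        have e2 : i + m + 1 - (i + 1) = m := by omega
        have e3 : i + m + 1 + 1 - (i + 1) = m + 1 := by omega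
        simp only [e1, e2, e3]
        rw [if_pos (by omega), if_pos (by omega), if_pos (by omega), shiftCoeff_succ_succ]
      · subst h
        simp [shiftCoeff_succ_zero]
      · rw [if_neg (by omega), if_neg (by omega), if_neg (by omega)]
        simp

theorem coeff_mul_range (a b : PsiDO d) (n N : ℕ) (h : n ≤ N) : (a * b).coeff n =
    ∑ i ∈ range (N + 1), a.coeff i * ((xi d * ·)^[i] b).coeff n := by
  rw [coeff_mul_eq, Finset.Nat.sum_antidiagonal_eq_sum_range_succ
    (fun i m => a.coeff i * shiftCoeff d b.coeff i m)]
  simp only [iterate_xi_coeff]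
  symm
  refine (Finset.sum_subset_zero_on_sdiff (range_subset_range.2 (by omega)) ?_ ?_).symm
  · intro x hx
    simp at hx
    rw [if_neg (by omega), mul_zero]
  · intro x hx
    simp at hx
    rw [if_pos (by omega)]

theorem iterate_xi_mul (y z : PsiDO d) (i : ℕ) :
    (xi d * ·)^[i] y * z = (xi d * ·)^[i] (y * z) := by
  induction i with
  | zero => rfl
  | succ i ih => rw [Function.iterate_succ_apply', Function.iterate_succ_apply', xi_mul_assoc, ih]

theorem sum_coeff {ι : Type*} (s : Finset ι) (f : ι → PsiDO d) (n : ℕ) :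
    (∑ i ∈ s, f i).coeff n = ∑ i ∈ s, (f i).coeff n := by
  exact map_sum ((Pi.evalAddMonoidHom (fun _ : ℕ => R) n).comp (coeffHom d)) f s

theorem add_mul' (a b c : PsiDO d) : (a + b) * c = a * c + b * c := by
  ext n
  simp [coeff_mul_eq, coeff_add, add_mul, Finset.sum_add_distrib]

theorem mul_add' (a b c : PsiDO d) : a * (b + c) = a * b + a * c := by
  ext n
  have : (b + c).coeff = b.coeff + c.coeff := rfl
  simp [coeff_mul_eq, coeff_add, this, shiftCoeff_add, mul_add, Finset.sum_add_distrib]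

theorem sum_smul_mul (s : Finset ℕ) (r : ℕ → R) (f : ℕ → PsiDO d) (z : PsiDO d) (n : ℕ) :
    ((∑ i ∈ s, r i • f i) * z).coeff n = ∑ i ∈ s, r i * (f i * z).coeff n := by
  simp only [coeff_mul_eq, sum_coeff, coeff_smul, smul_eq_mul, Finset.sum_mul, Finset.mul_sum]
  rw [Finset.sum_comm]
  simp [mul_assoc]

theorem mul_assoc' (x y z : PsiDO d) : x * y * z = x * (y * z) := by
  ext n
  have h : ∀ j ≤ n, (x * y).coeff j =
      (∑ i ∈ range (n + 1), x.coeff i • (xi d * ·)^[i] y).coeff j := fun j hj => by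
    rw [coeff_mul_range x y j n hj, sum_coeff]
    rfl
  rw [mul_congr h (fun _ _ => rfl), sum_smul_mul, coeff_mul_range x _ n n le_rfl]
  simp only [iterate_xi_mul]

theorem const_one : const d 1 = 1 := by
  ext n
  rfl

theorem mul_one' (a : PsiDO d) : a * 1 = a := by
  ext n
  have h : ∀ i m, shiftCoeff d (1 : PsiDO d).coeff i m = if m = 0 then 1 else 0 := fun i m => by
    induction i generalizing m with
    | zero => rw [shiftCoeff_zero, coeff_one]
    | succ i ih =>
      induction m with
      | zero => rw [shiftCoeff_succ_zero, ih]
      | succ m ihm =>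
        rw [shiftCoeff_succ_succ, ih, ihm]
        split_ifs <;> simp_all
  rw [coeff_mul_eq, Finset.sum_eq_single (n, 0)]
  · simp [h]
  · rintro ⟨x, y⟩ hxy hne
    have hy : y ≠ 0 := by
      rintro rfl
      simp at hxy
      exact hne (by simp [hxy])
    simp [h, hy]
  · simp

instance : Ring (PsiDO d) where
  __ := (inferInstance : AddCommGroup (PsiDO d))
  left_distrib := mul_add'
  right_distrib := add_mul'
  zero_mul a := by ext n; simp [coeff_mul_eq, coeff_zero]
  mul_zero a := by
    have h := mul_add' a 0 0
    rw [add_zero] at h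
    exact left_eq_add.mp h
  mul_assoc := mul_assoc'
  one_mul a := by ext n; rw [← const_one, const_mul_coeff, one_mul]
  mul_one := mul_one'

instance : Algebra k (PsiDO d) := Algebra.ofModule
  (fun c a b => by
    ext n
    simp [coeff_mul_eq, coeff_smul, Finset.smul_sum])
  (fun c a b => by
    ext n
    have : (c • b).coeff = c • b.coeff := rfl
    simp [coeff_mul_eq, coeff_smul, this, shiftCoeff_smul, Finset.smul_sum])

/-- The filtration of `PsiDO(R, ∂)_{≤ 0}` whose `n`-th step is `PsiDO(R, ∂)_{≤ -n}`. -/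
def filtration (d : Derivation k R R) (n : ℕ) : Submodule k (PsiDO d) where
  carrier := {a | ∀ j < n, a.coeff j = 0}
  zero_mem' _ _ := rfl
  add_mem' ha hb j hj := by rw [coeff_add, ha j hj, hb j hj, add_zero]
  smul_mem' c a ha j hj := by rw [coeff_smul, ha j hj, smul_zero]

/-- The operators all of whose coefficients lie in a subalgebra `O` of `R` stable under `∂`;
this is `PsiDO(O, ∂)_{≤ 0}` as a subalgebra of `PsiDO(R, ∂)_{≤ 0}`. -/
def withCoeffsIn (d : Derivation k R R) (O : Subalgebra k R) (hO : ∀ r ∈ O, d r ∈ O) :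
    Subalgebra k (PsiDO d) where
  carrier := {a | ∀ j, a.coeff j ∈ O}
  add_mem' ha hb j := O.add_mem (ha j) (hb j)
  mul_mem' {a b} ha hb n := by
    have h : ∀ m r, r ∈ O → d^[m] r ∈ O := fun m => by
      induction m with
      | zero => exact fun _ h => h
      | succ m ih => exact fun r hr => ih _ (hO r hr)
    rw [coeff_mul]
    exact O.sum_mem fun p _ => O.sum_mem fun q _ =>
      zsmul_mem (O.mul_mem (ha _) (h _ _ (hb _))) _
  algebraMap_mem' c j := by
    rw [Algebra.algebraMap_eq_smul_one, coeff_smul, coeff_one]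
    split_ifs
    · exact O.smul_mem O.one_mem c
    · simp

/-- Functoriality: a morphism `ρ` of differential rings induces
`∑ a_j D^{-j} ↦ ∑ ρ(a_j) D^{-j}`. -/
def map {S : Type*} [CommRing S] [Algebra k S] {e : Derivation k S S} (ρ : R →ₐ[k] S)
    (h : ∀ r, ρ (d r) = e (ρ r)) : PsiDO d →ₐ[k] PsiDO e :=
  AlgHom.ofLinearMap
    { toFun := fun a => ⟨fun n => ρ (a.coeff n)⟩
      map_add' := fun a b => by ext n; exact map_add ρ _ _
      map_smul' := fun c a => by ext n; exact map_smul ρ c _ }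
    (by
      ext n
      simp only [LinearMap.coe_mk, AddHom.coe_mk, coeff_one]
      split_ifs <;> simp)
    (fun a b => by
      have hi : ∀ (m : ℕ) (r : R), ρ (d^[m] r) = e^[m] (ρ r) := fun m => by
        induction m with
        | zero => exact fun _ => rfl
        | succ m ih =>
          intro r
          rw [Function.iterate_succ_apply, ih, h, Function.iterate_succ_apply]
      ext n
      simp only [LinearMap.coe_mk, AddHom.coe_mk, coeff_mul, map_sum, map_zsmul, map_mul, hi])

section ChangeDerivation

variable {d' : Derivation k R R}

/-- The operator `D_{g ∂'}^{-1} = D_{∂'}^{-1} g^{-1}` in `PsiDO(R, ∂')_{≤ 0}`. -/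
def eta (d' : Derivation k R R) (g : Rˣ) : PsiDO d' := xi d' * const d' ((g⁻¹ : Rˣ) : R)

theorem eta_mul (g : Rˣ) (b : PsiDO d') : eta d' g * b = xi d' * (((g⁻¹ : Rˣ) : R) • b) := by
  rw [eta, mul_assoc]
  congr 1
  ext n
  rw [const_mul_coeff, coeff_smul, smul_eq_mul]

theorem eta_pow_coeff_succ (g : Rˣ) (j n : ℕ) : (eta d' g ^ (j + 1)).coeff (n + 1) =
    ((g⁻¹ : Rˣ) : R) * (eta d' g ^ j).coeff n - d' ((eta d' g ^ (j + 1)).coeff n) := by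
  rw [pow_succ', eta_mul, xi_mul_coeff_succ, coeff_smul, smul_eq_mul]

theorem eta_pow_coeff_zero (g : Rˣ) (j : ℕ) : (eta d' g ^ (j + 1)).coeff 0 = 0 := by
  rw [pow_succ', eta_mul, xi_mul_coeff_zero]

theorem eta_pow_coeff_of_lt (g : Rˣ) {j n : ℕ} (h : n < j) : (eta d' g ^ j).coeff n = 0 := by
  induction n generalizing j with
  | zero =>
    obtain ⟨j, rfl⟩ := Nat.exists_eq_succ_of_ne_zero h.ne'
    exact eta_pow_coeff_zero g j
  | succ n ih =>
    obtain ⟨j, rfl⟩ := Nat.exists_eq_succ_of_ne_zero (by omega : j ≠ 0)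
    rw [eta_pow_coeff_succ, ih (by omega), ih (by omega), mul_zero, map_zero, sub_zero]

/-- The convergent series `∑ a_j (D_{∂'}^{-1} g^{-1})^j`. -/
def changeFun (d' : Derivation k R R) (g : Rˣ) (a : PsiDO d) : PsiDO d' :=
  ⟨fun n => ∑ j ∈ range (n + 1), a.coeff j * (eta d' g ^ j).coeff n⟩

theorem changeFun_coeff (g : Rˣ) (a : PsiDO d) {n N : ℕ} (h : n ≤ N) :
    (changeFun d' g a).coeff n = ∑ j ∈ range (N + 1), a.coeff j * (eta d' g ^ j).coeff n := by
  change ∑ j ∈ range (n + 1), a.coeff j * (eta d' g ^ j).coeff n = _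
  have hs : range (n + 1) ⊆ range (N + 1) := range_subset_range.2 (by omega)
  apply Finset.sum_subset hs
  intro x _ hx
  simp only [mem_range] at hx
  rw [eta_pow_coeff_of_lt g (by omega), mul_zero]

theorem changeFun_congr (g : Rˣ) {a b : PsiDO d} {n : ℕ} (h : ∀ j ≤ n, a.coeff j = b.coeff j) :
    (changeFun d' g a).coeff n = (changeFun d' g b).coeff n := by
  change ∑ j ∈ range (n + 1), a.coeff j * (eta d' g ^ j).coeff n =
    ∑ j ∈ range (n + 1), b.coeff j * (eta d' g ^ j).coeff n
  refine Finset.sum_congr rfl fun j hj => ?_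
  rw [h j (by simp at hj; omega)]

theorem changeFun_sum (g : Rˣ) (s : Finset ℕ) (r : ℕ → R) (f : ℕ → PsiDO d) :
    changeFun d' g (∑ i ∈ s, r i • f i) = ∑ i ∈ s, r i • changeFun d' g (f i) := by
  ext n
  simp only [changeFun, sum_coeff, coeff_smul, smul_eq_mul, Finset.sum_mul, Finset.mul_sum]
  rw [Finset.sum_comm]
  simp [mul_assoc]

theorem changeFun_xi_mul (g : Rˣ) (h : d = (g : R) • d') (y : PsiDO d) :
    changeFun d' g (xi d * y) = eta d' g * changeFun d' g y := by
  rw [eta_mul]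
  set w := xi d * y with hw
  have hw0 : w.coeff 0 = 0 := xi_mul_coeff_zero y
  refine eq_xi_mul (by simp [changeFun, hw0]) fun n => ?_
  have h1 : (changeFun d' g w).coeff (n + 1) = ∑ j ∈ range (n + 1), w.coeff (j + 1) *
      (((g⁻¹ : Rˣ) : R) * (eta d' g ^ j).coeff n - d' ((eta d' g ^ (j + 1)).coeff n)) := by
    change ∑ j ∈ range (n + 1 + 1), _ = _
    rw [Finset.sum_range_succ']
    simp only [hw0, zero_mul, add_zero, eta_pow_coeff_succ]
  have h2 : d' ((changeFun d' g w).coeff n) = ∑ j ∈ range (n + 1),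
      ((eta d' g ^ j).coeff n * d' (w.coeff j) +
        w.coeff (j + 1) * d' ((eta d' g ^ (j + 1)).coeff n)) := by
    rw [Finset.sum_add_distrib, Finset.sum_range_succ (fun j => w.coeff (j + 1) * _),
      eta_pow_coeff_of_lt g (Nat.lt_succ_self n), map_zero, mul_zero, add_zero]
    have : ∑ j ∈ range n, w.coeff (j + 1) * d' ((eta d' g ^ (j + 1)).coeff n) =
        ∑ j ∈ range (n + 1), w.coeff j * d' ((eta d' g ^ j).coeff n) := by
      rw [Finset.sum_range_succ']
      simp [hw0]
    rw [this, ← Finset.sum_add_distrib]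
    change d' (∑ j ∈ range (n + 1), _) = _
    rw [map_sum]
    refine Finset.sum_congr rfl fun j _ => ?_
    rw [Derivation.leibniz]
    simp only [smul_eq_mul]
    ring
  rw [h1, h2, coeff_smul, smul_eq_mul]
  change _ = _ * (∑ j ∈ range (n + 1), _) - _
  rw [Finset.mul_sum, ← Finset.sum_sub_distrib]
  refine Finset.sum_congr rfl fun j _ => ?_
  have hy : y.coeff j = w.coeff (j + 1) + (g : R) * d' (w.coeff j) := by
    have h3 : d (w.coeff j) = (g : R) * d' (w.coeff j) := by
      rw [DFunLike.congr_fun h (w.coeff j)]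
      simp
    rw [← h3, hw, xi_mul_coeff_succ]
    ring
  rw [hy]
  linear_combination (-(eta d' g ^ j).coeff n * d' (w.coeff j)) * g.inv_mul

theorem changeFun_mul (g : Rˣ) (h : d = (g : R) • d') (x y : PsiDO d) :
    changeFun d' g (x * y) = changeFun d' g x * changeFun d' g y := by
  have hi : ∀ i, changeFun d' g ((xi d * ·)^[i] y) = eta d' g ^ i * changeFun d' g y := fun i => by
    induction i with
    | zero => simp
    | succ i ih =>
      rw [Function.iterate_succ_apply', changeFun_xi_mul g h, ih, pow_succ', mul_assoc]
  ext n
  have h1 : ∀ j ≤ n, (x * y).coeff j =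
      (∑ i ∈ range (n + 1), x.coeff i • (xi d * ·)^[i] y).coeff j := fun j hj => by
    rw [coeff_mul_range x y j n hj, sum_coeff]
    rfl
  have h2 : ∀ j ≤ n, (changeFun d' g x).coeff j =
      (∑ i ∈ range (n + 1), x.coeff i • eta d' g ^ i).coeff j := fun j hj => by
    rw [changeFun_coeff g x hj, sum_coeff]
    rfl
  rw [changeFun_congr g h1, changeFun_sum, mul_congr h2 (fun _ _ => rfl), sum_smul_mul, sum_coeff]
  refine Finset.sum_congr rfl fun i _ => ?_
  rw [hi, coeff_smul, smul_eq_mul]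

/-- For `∂ = g ∂'` with `g` invertible, the isomorphism `i_{∂,∂'}` from `PsiDO(R, ∂)_{≤ 0}` to
`PsiDO(R, ∂')_{≤ 0}`; it is the substitution `D_∂ = g D_{∂'}`, that is,
`∑ a_j D_∂^{-j} ↦ ∑ a_j (D_{∂'}^{-1} g^{-1})^j`. -/
def changeDerivation (g : Rˣ) (h : d = (g : R) • d') : PsiDO d →ₐ[k] PsiDO d' :=
  AlgHom.ofLinearMap
    { toFun := changeFun d' g
      map_add' := fun a b => by
        ext n
        simp [changeFun, coeff_add, add_mul, Finset.sum_add_distrib]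
      map_smul' := fun c a => by
        ext n
        simp [changeFun, coeff_smul, Finset.smul_sum] }
    (by
      ext n
      simp [changeFun, coeff_one])
    (changeFun_mul g h)

end ChangeDerivation

end PsiDO

end PseudodifferentialOperators

theorem laurent_derivative_coeff (f : ℂ⸨X⸩) (n : ℤ) :
    (LaurentSeries.derivative ℂ f).coeff n = (n + 1 : ℂ) * f.coeff (n + 1) := by
  rw [LaurentSeries.derivative_apply, LaurentSeries.hasseDeriv_coeff]
  simp

theorem laurent_coeff_mul (f g : ℂ⸨X⸩) {M N n : ℤ} (hf : ∀ i < M, f.coeff i = 0)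
    (hg : ∀ i < N, g.coeff i = 0) :
    (f * g).coeff n = ∑ i ∈ Finset.Icc M (n - N), f.coeff i * g.coeff (n - i) := by
  classical
  have h1 : (Set.Ici M).IsPWO := (BddBelow.isWF ⟨M, fun _ h => h⟩).isPWO
  rw [HahnSeries.coeff_mul_left' h1 (fun i hi => by
    by_contra h
    exact hi (hf i (not_le.1 h)))]
  symm
  refine Finset.sum_bij_ne_zero (fun i _ _ => (i, n - i)) ?_ ?_ ?_ ?_
  · intro i hi hne
    simp only [Finset.mem_Icc] at hi
    simp only [Finset.mem_antidiagonal, Set.mem_Ici, HahnSeries.mem_support]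
    exact ⟨hi.1, right_ne_zero_of_mul hne, by ring⟩
  · intro i _ _ j _ _ h
    exact (Prod.ext_iff.1 h).1
  · rintro ⟨i, j⟩ hij hne
    simp only [Finset.mem_antidiagonal, Set.mem_Ici, HahnSeries.mem_support] at hij
    obtain ⟨h1, h2, h3⟩ := hij
    have h4 : N ≤ j := by
      by_contra h
      exact h2 (hg j (not_le.1 h))
    obtain rfl : j = n - i := by omega
    exact ⟨i, by simp only [Finset.mem_Icc]; omega, hne, rfl⟩
  · intro i _ _
    rfl

/-- The derivation `d/dz` of the field `ℂ((z))`. -/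
noncomputable def laurentDeriv : Derivation ℂ ℂ⸨X⸩ ℂ⸨X⸩ :=
  Derivation.mk'
    { toFun := fun f => LaurentSeries.derivative ℂ f
      map_add' := fun f g => map_add _ f g
      map_smul' := fun c f => by
        ext n
        simp only [laurent_derivative_coeff, RingHom.id_apply]
        change _ * (c * _) = c * ((LaurentSeries.derivative ℂ f).coeff n)
        rw [laurent_derivative_coeff]
        ring }
    (fun f g => by
      ext n
      have hb : ∀ x : ℂ⸨X⸩, ∃ M : ℤ, ∀ i < M + 1, x.coeff i = 0 := fun x =>
        ⟨x.order - 1, fun i hi => HahnSeries.coeff_eq_zero_of_lt_order (by omega)⟩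
      obtain ⟨M, hM⟩ := hb f
      obtain ⟨N, hN⟩ := hb g
      have hd : ∀ (x : ℂ⸨X⸩) (K : ℤ), (∀ i < K + 1, x.coeff i = 0) →
          ∀ i < K, (LaurentSeries.derivative ℂ x).coeff i = 0 := fun x K h i hi => by
        rw [laurent_derivative_coeff, h _ (by omega), mul_zero]
      simp only [LinearMap.coe_mk, AddHom.coe_mk, smul_eq_mul, HahnSeries.coeff_add]
      rw [laurent_derivative_coeff,
        laurent_coeff_mul f g (M := M + 1) (N := N + 1) hM hN,
        laurent_coeff_mul f _ (M := M + 1) (N := N) hM (hd g N hN), mul_comm g,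
        laurent_coeff_mul _ g (M := M) (N := N + 1) (hd f M hM) hN]
      have e1 : n + 1 - (N + 1) = n - N := by ring
      have e2 : n - (N + 1) = n - N - 1 := by ring
      rw [e1, e2]
      have e3 : ∑ i ∈ Finset.Icc M (n - N - 1),
          (LaurentSeries.derivative ℂ f).coeff i * g.coeff (n - i) =
          ∑ i ∈ Finset.Icc (M + 1) (n - N), (i : ℂ) * f.coeff i * g.coeff (n + 1 - i) := by
        refine Finset.sum_bij (fun i _ => i + 1) ?_ ?_ ?_ ?_
        · intro i hi
          simp only [Finset.mem_Icc] at hi ⊢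
          omega
        · intro i _ j _ h
          simpa using h
        · intro i hi
          simp only [Finset.mem_Icc] at hi
          exact ⟨i - 1, by simp only [Finset.mem_Icc]; omega, by ring⟩
        · intro i _
          rw [laurent_derivative_coeff]
          congr 2
          · push_cast
            rfl
          · ring
      rw [e3, Finset.mul_sum, ← Finset.sum_add_distrib]
      refine Finset.sum_congr rfl fun i _ => ?_
      rw [laurent_derivative_coeff]
      have e4 : n - i + 1 = n + 1 - i := by ring
      rw [e4]
      push_cast
      ring)

theorem laurentDeriv_coeff (f : ℂ⸨X⸩) (n : ℤ) :
    (laurentDeriv f).coeff n = (n + 1 : ℂ) * f.coeff (n + 1) :=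
  laurent_derivative_coeff f n

/-- The subalgebra `ℂ[[z]]` of `ℂ((z))`. -/
noncomputable def laurentIntegers : Subalgebra ℂ ℂ⸨X⸩ :=
  (HahnSeries.ofPowerSeriesAlg ℤ ℂ (A := ℂ)).range

theorem mem_laurentIntegers (f : ℂ⸨X⸩) : f ∈ laurentIntegers ↔ ∀ n < 0, f.coeff n = 0 := by
  constructor
  · rintro ⟨p, rfl⟩ n hn
    change (HahnSeries.ofPowerSeries ℤ ℂ p).coeff n = 0
    rw [PowerSeries.coeff_coe, if_pos hn]
  · intro h
    refine ⟨PowerSeries.mk fun n => f.coeff n, ?_⟩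
    ext n
    change (HahnSeries.ofPowerSeries ℤ ℂ _).coeff n = _
    rw [PowerSeries.coeff_coe]
    split_ifs with hn
    · exact (h n hn).symm
    · rw [PowerSeries.coeff_mk, Int.natAbs_of_nonneg (not_lt.1 hn)]

/-- The derivation `z^δ d/dz` of `ℂ((z))`. -/
noncomputable def laurentDerivPow (δ : ℕ) : Derivation ℂ ℂ⸨X⸩ ℂ⸨X⸩ :=
  (HahnSeries.single (1 : ℤ) (1 : ℂ)) ^ δ • laurentDeriv

theorem laurentDerivPow_mem (δ : ℕ) (f : ℂ⸨X⸩) (hf : f ∈ laurentIntegers) :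
    laurentDerivPow δ f ∈ laurentIntegers := by
  have h1 : HahnSeries.single (1 : ℤ) (1 : ℂ) ∈ laurentIntegers := by
    rw [mem_laurentIntegers]
    intro n hn
    exact HahnSeries.coeff_single_of_ne (by omega)
  refine laurentIntegers.mul_mem (laurentIntegers.pow_mem h1 δ) ?_
  rw [mem_laurentIntegers] at hf ⊢
  intro n hn
  refine (laurentDeriv_coeff f n).trans ?_
  by_cases h : n + 1 < 0
  · rw [hf _ h, mul_zero]
  · obtain rfl : n = -1 := by omega
    simp

/-- The invertible element `z^δ` of `ℂ((z))`. -/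
noncomputable def zPow (δ : ℕ) : ℂ⸨X⸩ˣ :=
  Units.mk0 (HahnSeries.single (1 : ℤ) (1 : ℂ)) (by simp) ^ δ

/-- The subalgebra `PsiDO(ℂ[[z]], z^δ d/dz)_{≤ 0}` of `PsiDO(ℂ((z)), d/dz)_{≤ 0}`. -/
noncomputable def localRegular (δ : ℕ) : Subalgebra ℂ (PsiDO laurentDeriv) :=
  (PsiDO.withCoeffsIn (laurentDerivPow δ) laurentIntegers (laurentDerivPow_mem δ)).map
    (PsiDO.changeDerivation (d := laurentDerivPow δ) (d' := laurentDeriv) (zPow δ) (by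
      simp [laurentDerivPow, zPow]))

/-- A smooth projective connected complex curve: a proper, integral scheme, smooth of relative
dimension one over `ℂ`. -/
structure ComplexCurve where
  scheme : Scheme.{0}
  toBase : scheme ⟶ Spec (.of ℂ)
  [isIntegral : IsIntegral scheme]
  [isProper : IsProper toBase]
  [smooth : SmoothOfRelativeDimension 1 toBase]

attribute [instance] ComplexCurve.isIntegral ComplexCurve.isProper ComplexCurve.smooth

namespace ComplexCurve

variable (C : ComplexCurve)

/-- The local ring `O_{C,x}`. -/
abbrev Stalk (x : C.scheme) : Type := C.scheme.presheaf.stalk x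

/-- The field `ℂ(C)` of rational functions on `C`. -/
abbrev K : Type := C.scheme.functionField

/-- The (closed) points of `C`. -/
def Point : Type := {x : C.scheme // IsClosed {x}}

/-- The inclusion of the constants `ℂ` in a local ring of `C`. -/
noncomputable def baseToStalk (x : C.scheme) : ℂ →+* C.Stalk x :=
  ((Scheme.ΓSpecIso (.of ℂ)).inv ≫ C.toBase.appTop ≫
    C.scheme.presheaf.germ ⊤ x trivial).hom

noncomputable instance (x : C.scheme) : Algebra ℂ (C.scheme.presheaf.stalk x) :=
  (C.baseToStalk x).toAlgebra

instance (x : C.scheme) :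
    IsScalarTower ℂ (C.scheme.presheaf.stalk x) C.scheme.functionField := by
  apply IsScalarTower.of_algebraMap_eq'
  change (C.baseToStalk _) = RingHom.comp (CommRingCat.Hom.hom _) (C.baseToStalk _)
  rw [baseToStalk, baseToStalk, ← CommRingCat.hom_comp, Category.assoc, Category.assoc]
  congr 3
  exact (TopCat.Presheaf.germ_stalkSpecializes C.scheme.presheaf (U := ⊤) trivial
    ((genericPoint_spec C.scheme).specializes trivial)).symm

instance (x : C.scheme) : Algebra.EssFiniteType ℂ (C.scheme.presheaf.stalk x) := by
  have h1 := LocallyOfFiniteType.stalkMap C.toBase x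
  have h2 : C.baseToStalk x = (C.toBase.stalkMap x).hom.comp ((Scheme.ΓSpecIso (.of ℂ)).inv ≫
      (Spec (.of ℂ)).presheaf.germ ⊤ (C.toBase x) trivial).hom := by
    rw [baseToStalk, ← CommRingCat.hom_comp, Category.assoc]
    congr 2
    exact (Scheme.Hom.germ_stalkMap C.toBase ⊤ x trivial).symm
  have h3 : ((Scheme.ΓSpecIso (.of ℂ)).inv ≫
      (Spec (.of ℂ)).presheaf.germ ⊤ (C.toBase x) trivial).hom.EssFiniteType := by
    let p : PrimeSpectrum ℂ := C.toBase x
    have h5 := StructureSheaf.IsLocalization.to_stalk ℂ p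
    have h6 := RingHom.EssFiniteType.holdsForLocalization
      (S := (Spec.structureSheaf ℂ).presheaf.stalk p) p.asIdeal.primeCompl
    exact h6
  have h4 := RingHom.EssFiniteType.comp h3 h1
  rw [← h2] at h4
  exact h4

variable {C}

/-- A formal local coordinate `z` at the point `P`, given by the Laurent expansion
`ℓ_P : ℂ(C) → ℂ((z))` it defines: an embedding over `ℂ` for which `O_{C,P}` is the preimage of
`ℂ[[z]]` and some rational function has order one. Such an embedding amounts to an isomorphism of
`ℂ[[z]]` with the completion of `O_{C,P}`, that is, to a generator `z` of the maximal ideal of this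
completion. -/
structure LocalCoordinate (P : C.Point) where
  expand : C.K →ₐ[ℂ] ℂ⸨X⸩
  mem_stalk_iff : ∀ f : C.K, f ∈ (algebraMap (C.Stalk P.1) C.K).range ↔
    expand f ∈ laurentIntegers
  exists_order_one : ∃ t : C.K, (expand t).order = 1

/-- A derivation of the fraction field of a local ring `O` into a field vanishes if it kills a
generator `t` of the maximal ideal of `O` and `O = ℂ + t O`. -/
theorem derivation_eq_zero {O K L : Type*} [CommRing O] [IsLocalRing O] [Field K] [Field L]
    [Algebra ℂ O] [Algebra ℂ K] [Algebra ℂ L] [Algebra O K] [IsFractionRing O K]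
    [IsScalarTower ℂ O K] [Algebra.EssFiniteType ℂ O] [Algebra K L] [IsScalarTower ℂ K L]
    (t : O) (ht : t ∈ IsLocalRing.maximalIdeal O)
    (H : ∀ f : O, ∃ (c : ℂ) (h : O), f = algebraMap ℂ O c + t * h)
    (δ : Derivation ℂ K L) (hδ : δ (algebraMap O K t) = 0) : δ = 0 := by
  let _ : Algebra O L := ((algebraMap K L).comp (algebraMap O K)).toAlgebra
  have : IsScalarTower O K L := IsScalarTower.of_algebraMap_eq' rfl
  have : IsScalarTower ℂ O L := IsScalarTower.of_algebraMap_eq fun c => by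
    rw [IsScalarTower.algebraMap_apply ℂ K L, IsScalarTower.algebraMap_apply ℂ O K]
    rfl
  have top_le : (⊤ : Submodule O (Ω[O⁄ℂ])) ≤ Submodule.span O {KaehlerDifferential.D ℂ O t} := by
    refine Submodule.le_of_le_smul_of_le_jacobson_bot (I := IsLocalRing.maximalIdeal O)
      Module.Finite.fg_top (IsLocalRing.maximalIdeal_le_jacobson _) ?_
    rw [← KaehlerDifferential.span_range_derivation ℂ O, Submodule.span_le]
    rintro _ ⟨f, rfl⟩
    obtain ⟨c, h, rfl⟩ := H f
    rw [map_add, Derivation.map_algebraMap, zero_add, Derivation.leibniz, add_comm]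
    refine Submodule.add_mem_sup ?_ ?_
    · exact Submodule.smul_mem _ _ (Submodule.mem_span_singleton_self _)
    · refine Submodule.smul_mem_smul ht ?_
      exact Submodule.subset_span ⟨h, rfl⟩
  let δO : Derivation ℂ O L := δ.compAlgebraMap O
  have h0 : ∀ ω : Ω[O⁄ℂ], δO.liftKaehlerDifferential ω = 0 := fun ω => by
    obtain ⟨a, rfl⟩ := Submodule.mem_span_singleton.1 (top_le (Submodule.mem_top (x := ω)))
    rw [map_smul, Derivation.liftKaehlerDifferential_comp_D]
    change a • δ (algebraMap O K t) = 0
    rw [hδ, smul_zero]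
  have h1 : ∀ f : O, δ (algebraMap O K f) = 0 := fun f => by
    have := h0 (KaehlerDifferential.D ℂ O f)
    rwa [Derivation.liftKaehlerDifferential_comp_D] at this
  ext x
  obtain ⟨a, b, hb, rfl⟩ := IsFractionRing.div_surjective (A := O) x
  rw [div_eq_mul_inv, Derivation.leibniz, Derivation.leibniz_inv, h1, h1]
  simp

namespace LocalCoordinate

variable {P : C.Point}

theorem exists_uniformizer (z : LocalCoordinate P) : ∃ t : C.Stalk P.1,
    (z.expand (algebraMap _ C.K t)).order = 1 ∧ t ∈ IsLocalRing.maximalIdeal (C.Stalk P.1) ∧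
    ∀ f : C.Stalk P.1, ∃ (c : ℂ) (h : C.Stalk P.1), f = algebraMap ℂ _ c + t * h := by
  obtain ⟨t, ht⟩ := z.exists_order_one
  have ht0 : z.expand t ≠ 0 := by
    intro h
    rw [h, HahnSeries.order_zero] at ht
    exact zero_ne_one ht
  have htint : z.expand t ∈ laurentIntegers := by
    rw [mem_laurentIntegers]
    intro n hn
    exact HahnSeries.coeff_eq_zero_of_lt_order (by omega)
  obtain ⟨t0, rfl⟩ := (z.mem_stalk_iff t).2 htint
  refine ⟨t0, ht, ?_, fun f => ?_⟩
  · rw [IsLocalRing.mem_maximalIdeal, mem_nonunits_iff]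
    rintro ⟨u, rfl⟩
    have h1 : z.expand (algebraMap _ C.K ((u⁻¹ : (C.Stalk P.1)ˣ) : C.Stalk P.1)) ∈
        laurentIntegers := (z.mem_stalk_iff _).1 ⟨_, rfl⟩
    have h2 : z.expand (algebraMap _ C.K (u : C.Stalk P.1)) *
        z.expand (algebraMap _ C.K ((u⁻¹ : (C.Stalk P.1)ˣ) : C.Stalk P.1)) = 1 := by
      rw [← map_mul, ← map_mul, Units.mul_inv, map_one, map_one]
    have h3 := HahnSeries.order_mul ht0 (right_ne_zero_of_mul_eq_one h2)
    rw [h2, HahnSeries.order_one, ht] at h3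
    rw [mem_laurentIntegers] at h1
    have h4 := h1 (z.expand (algebraMap _ C.K ((u⁻¹ : (C.Stalk P.1)ˣ) : C.Stalk P.1))).order
      (by omega)
    exact (right_ne_zero_of_mul_eq_one h2) (HahnSeries.coeff_order_eq_zero.1 h4)
  · set F := z.expand (algebraMap _ C.K f) with hF
    set T := z.expand (algebraMap _ C.K t0) with hT
    let c : ℂ := F.coeff 0
    have hFint : F ∈ laurentIntegers := (z.mem_stalk_iff _).1 ⟨_, rfl⟩
    rw [mem_laurentIntegers] at hFint
    have hq : (F - algebraMap ℂ ℂ⸨X⸩ c) / T ∈ laurentIntegers := by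
      rw [mem_laurentIntegers]
      intro n hn
      by_contra hne
      set w := (F - algebraMap ℂ ℂ⸨X⸩ c) / T with hw
      have hw0 : w ≠ 0 := fun h => hne (by rw [h, HahnSeries.coeff_zero])
      have h1 : T * w = F - algebraMap ℂ ℂ⸨X⸩ c := mul_div_cancel₀ _ ht0
      have h2 := HahnSeries.order_mul ht0 hw0
      have h3 : w.order ≤ n := HahnSeries.order_le_of_coeff_ne_zero hne
      have h4 : (T * w).coeff (T * w).order ≠ 0 := fun h =>
        mul_ne_zero ht0 hw0 (HahnSeries.coeff_order_eq_zero.1 h)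
      apply h4
      rw [h2, ht, h1, HahnSeries.coeff_sub, HahnSeries.algebraMap_apply]
      rcases lt_or_eq_of_le (show 1 + w.order ≤ 0 by omega) with h | h
      · rw [hFint _ h]
        simp [HahnSeries.C_apply, HahnSeries.coeff_single_of_ne h.ne]
      · rw [h]
        simp [c]
    have hq2 : (F - algebraMap ℂ ℂ⸨X⸩ c) / T =
        z.expand ((algebraMap _ C.K f - algebraMap ℂ C.K c) / algebraMap _ C.K t0) := by
      rw [map_div₀, map_sub, AlgHom.commutes]
    rw [hq2] at hq
    obtain ⟨h, hh⟩ := (z.mem_stalk_iff _).2 hq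
    refine ⟨c, h, IsFractionRing.injective (C.Stalk P.1) C.K ?_⟩
    have ht1 : algebraMap (C.Stalk P.1) C.K t0 ≠ 0 := fun h => ht0 (by rw [hT, h, map_zero])
    rw [map_add, map_mul, hh, mul_div_cancel₀ _ ht1, ← IsScalarTower.algebraMap_apply]
    ring

/-- The local expansion of a vector field: `X = X(z) d/dz` with `X(z)` invertible. -/
theorem exists_localFactor (z : LocalCoordinate P) (X : Derivation ℂ C.K C.K) (hX : X ≠ 0) :
    ∃ g : ℂ⸨X⸩ˣ, ∀ f, z.expand (X f) = ((g : ℂ⸨X⸩) • laurentDeriv) (z.expand f) := by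
  obtain ⟨t, ht, htm, H⟩ := z.exists_uniformizer
  let _ : Algebra C.K ℂ⸨X⸩ := z.expand.toRingHom.toAlgebra
  have : IsScalarTower ℂ C.K ℂ⸨X⸩ :=
    IsScalarTower.of_algebraMap_eq fun c => (z.expand.commutes c).symm
  have hT : laurentDeriv (z.expand (algebraMap _ C.K t)) ≠ 0 := fun h => by
    have h1 := laurentDeriv_coeff (z.expand (algebraMap _ C.K t)) 0
    have h0 : z.expand (algebraMap _ C.K t) ≠ 0 := by
      intro h
      rw [h, HahnSeries.order_zero] at ht
      exact zero_ne_one ht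
    rw [h] at h1
    have h2 : (z.expand (algebraMap _ C.K t)).coeff 1 = 0 := by simpa using h1.symm
    rw [← ht] at h2
    exact h0 (HahnSeries.coeff_order_eq_zero.1 h2)
  set g : ℂ⸨X⸩ := z.expand (X (algebraMap _ C.K t)) /
    laurentDeriv (z.expand (algebraMap _ C.K t)) with hg
  let δ : Derivation ℂ C.K ℂ⸨X⸩ := Derivation.mk'
    (z.expand.toLinearMap ∘ₗ X.toLinearMap -
      g • (laurentDeriv.toLinearMap ∘ₗ z.expand.toLinearMap)) (fun a b => by
        change z.expand (X (a * b)) - g * laurentDeriv (z.expand (a * b)) =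
          z.expand a * (z.expand (X b) - g * laurentDeriv (z.expand b)) +
          z.expand b * (z.expand (X a) - g * laurentDeriv (z.expand a))
        simp only [Derivation.leibniz, map_mul, map_add, smul_eq_mul]
        ring)
  have hδ : δ = 0 := derivation_eq_zero t htm H δ (by
    change z.expand (X (algebraMap _ C.K t)) -
      g * laurentDeriv (z.expand (algebraMap _ C.K t)) = 0
    rw [hg, div_mul_cancel₀ _ hT, sub_self])
  have h1 : ∀ f, z.expand (X f) = g * laurentDeriv (z.expand f) := fun f => by
    have h2 : z.expand (X f) - g * laurentDeriv (z.expand f) = 0 := DFunLike.congr_fun hδ f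
    exact sub_eq_zero.1 h2
  have hg0 : g ≠ 0 := fun h => hX (by
    ext f
    have h2 := h1 f
    rw [h, zero_mul] at h2
    exact (map_eq_zero z.expand).1 h2)
  exact ⟨Units.mk0 g hg0, h1⟩

/-- The Laurent series `X(z)` with `X = X(z) d/dz`. -/
noncomputable def localFactor (z : LocalCoordinate P) {X : Derivation ℂ C.K C.K} (hX : X ≠ 0) :
    ℂ⸨X⸩ˣ := (z.exists_localFactor X hX).choose

/-- The Laurent expansion morphism `L_P^z`, from `PsiDO(ℂ(C), X)_{≤ 0}` to
`PsiDO(ℂ((z)), d/dz)_{≤ 0}`. -/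
noncomputable def laurentMap (z : LocalCoordinate P) {X : Derivation ℂ C.K C.K} (hX : X ≠ 0) :
    PsiDO X →ₐ[ℂ] PsiDO laurentDeriv :=
  (PsiDO.changeDerivation (z.localFactor hX) rfl).comp
    (PsiDO.map z.expand (z.exists_localFactor X hX).choose_spec)

end LocalCoordinate

/-- An effective divisor `∑ δ_P P`. -/
abbrev EffectiveDivisor (C : ComplexCurve) : Type := C.Point →₀ ℕ

/-- The algebra `B_X^{C,rat} = PsiDO(ℂ(C), X)_{≤ 0}`. -/
abbrev BRat (C : ComplexCurve) (X : Derivation ℂ C.K C.K) : Type := PsiDO X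

/-- The algebra `B_X^{(C,D)}`: the preimage of `∏_P PsiDO(ℂ[[z_P]], z_P^{δ_P} d/dz_P)_{≤ 0}` under
the Laurent expansions `∏_P L_P^{z_P}`, for a choice `z = (z_P)_P` of local coordinates. -/
noncomputable def BReg (z : ∀ P : C.Point, LocalCoordinate P) {X : Derivation ℂ C.K C.K}
    (hX : X ≠ 0) (D : EffectiveDivisor C) : Subalgebra ℂ (BRat C X) :=
  ⨅ P : C.Point, (localRegular (D P)).comap ((z P).laurentMap hX)

/-- A possibly ramified covering `φ : C → C'`: a finite surjective morphism of curves over `ℂ`. -/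
structure Covering (C C' : ComplexCurve) where
  hom : C.scheme ⟶ C'.scheme
  comm : hom ≫ C'.toBase = C.toBase
  [isFinite : IsFinite hom]
  [surjective : Surjective hom]

attribute [instance] Covering.isFinite Covering.surjective

namespace Covering

variable {C C' : ComplexCurve} (φ : Covering C C')

theorem map_genericPoint : φ.hom (genericPoint C.scheme) = genericPoint C'.scheme := by
  apply ((genericPoint_spec C'.scheme).eq _).symm
  have h := (genericPoint_spec C.scheme).image φ.hom.continuous
  rwa [Set.image_univ, φ.hom.surjective.range_eq, closure_univ] at h

theorem pullback_comm (c : ℂ) :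
    (C'.scheme.presheaf.stalkSpecializes (specializes_of_eq φ.map_genericPoint) ≫
      φ.hom.stalkMap (genericPoint C.scheme)).hom (C'.baseToStalk _ c) = C.baseToStalk _ c := by
  have h1 : C'.scheme.presheaf.germ ⊤ (genericPoint C'.scheme) trivial ≫
      C'.scheme.presheaf.stalkSpecializes (specializes_of_eq φ.map_genericPoint) ≫
        φ.hom.stalkMap (genericPoint C.scheme) =
      φ.hom.appTop ≫ C.scheme.presheaf.germ ⊤ (genericPoint C.scheme) trivial := by
    rw [← Category.assoc]
    refine (congrArg (· ≫ φ.hom.stalkMap (genericPoint C.scheme))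
      (TopCat.Presheaf.germ_stalkSpecializes C'.scheme.presheaf (U := ⊤) trivial
        (specializes_of_eq φ.map_genericPoint))).trans ?_
    exact Scheme.Hom.germ_stalkMap φ.hom ⊤ (genericPoint C.scheme) trivial
  have h2 : C'.toBase.appTop ≫ φ.hom.appTop = C.toBase.appTop := by
    rw [← φ.comm, Scheme.Hom.comp_appTop]
  have h3 := congrArg (fun f => ((Scheme.ΓSpecIso (.of ℂ)).inv ≫ C'.toBase.appTop ≫ f).hom c) h1
  simp only at h3
  refine h3.trans ?_
  rw [← Category.assoc C'.toBase.appTop, h2]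
  rfl

/-- The inclusion of fields `φ^* : ℂ(C') → ℂ(C)`. -/
noncomputable def pullback : C'.K →ₐ[ℂ] C.K :=
  { (C'.scheme.presheaf.stalkSpecializes (specializes_of_eq φ.map_genericPoint) ≫
      φ.hom.stalkMap (genericPoint C.scheme)).hom with
    commutes' := φ.pullback_comm }

/-- The image `φ(P)` of a point. -/
def mapPoint (P : C.Point) : C'.Point :=
  ⟨φ.hom P.1, by
    have h := φ.hom.isClosedMap _ P.2
    rwa [Set.image_singleton] at h⟩

/-- The ramification index `ν_P`: the largest `n` such that the maximal ideal at `φ(P)` is mapped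
by `φ^*` into the `n`-th power of the maximal ideal at `P`. -/
noncomputable def ramificationIndex (P : C.Point) : ℕ :=
  sSup {n : ℕ | (IsLocalRing.maximalIdeal (C'.Stalk (φ.hom P.1))).map (φ.hom.stalkMap P.1).hom ≤
    IsLocalRing.maximalIdeal (C.Stalk P.1) ^ n}

/-- The effective divisor `φ^{-1}(D') = ∑_P max(0, δ_{φ(P)} ν_P - (ν_P - 1)) P` of `C`, where
`D' = ∑ δ_{P'} P'` (the subtractions are truncated at zero). -/
noncomputable def preimage (D' : EffectiveDivisor C') : EffectiveDivisor C :=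
  Finsupp.ofSupportFinite
    (fun P => D' (φ.mapPoint P) * φ.ramificationIndex P - (φ.ramificationIndex P - 1)) (by
      have h1 : (φ.hom ⁻¹' ((fun Q : C'.Point => Q.1) '' (D'.support : Set C'.Point))).Finite :=
        φ.hom.finite_preimage (D'.support.finite_toSet.image _)
      refine (h1.preimage Subtype.val_injective.injOn).subset ?_
      intro P hP
      refine ⟨φ.mapPoint P, ?_, rfl⟩
      rw [Finset.mem_coe, Finsupp.mem_support_iff]
      intro h0
      exact hP (by simp [h0]))

end Covering

end ComplexCurve

section Differentials

variable {A B : Type*} [CommRing A] [CommRing B] [Algebra ℂ A] [Algebra ℂ B]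

/-- The pullback of differentials `f dg ↦ φ(f) d(φ(g))` along a morphism of `ℂ`-algebras. -/
noncomputable def pullbackDifferential (φ : A →ₐ[ℂ] B) : Ω[A⁄ℂ] →ₗ[ℂ] Ω[B⁄ℂ] :=
  letI := φ.toRingHom.toAlgebra
  haveI : IsScalarTower ℂ A B := IsScalarTower.of_algebraMap_eq fun c => (φ.commutes c).symm
  (KaehlerDifferential.map ℂ ℂ A B).restrictScalars ℂ

/-- The algebra `⊕_i {rational i-differentials}` over `A = ℂ(C)`: the symmetric algebra of
the module of differentials (which is one-dimensional over `ℂ(C)`, so that symmetric powers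
and tensor powers coincide). -/
abbrev DiffAlgebra (A : Type*) [CommRing A] [Algebra ℂ A] : Type _ :=
  SymmetricAlgebra A (Ω[A⁄ℂ])

/-- The `1`-differential `ω` as a homogeneous element of degree one. -/
noncomputable def toDiffAlgebra : Ω[A⁄ℂ] →ₗ[A] DiffAlgebra A :=
  SymmetricAlgebra.ι A (Ω[A⁄ℂ])

/-- The pullback of `i`-differentials, all `i` together. -/
noncomputable def pullbackClassical (φ : A →ₐ[ℂ] B) :
    DiffAlgebra A →ₐ[ℂ] DiffAlgebra B :=
  letI := φ.toRingHom.toAlgebra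
  haveI : IsScalarTower ℂ A B := IsScalarTower.of_algebraMap_eq fun c => (φ.commutes c).symm
  (SymmetricAlgebra.lift (((SymmetricAlgebra.ι B (Ω[B⁄ℂ])).restrictScalars A) ∘ₗ
    KaehlerDifferential.map ℂ ℂ A B)).restrictScalars ℂ

end Differentials

namespace ComplexCurve

variable {C C' : ComplexCurve}

/-- `A^{C,rat} = ⊕_i {rational i-differentials on C}`. -/
abbrev ARat (C : ComplexCurve) : Type := DiffAlgebra C.K

/-- The rational `i`-differentials on `C`. -/
noncomputable def ratDifferentials (C : ComplexCurve) (i : ℕ) : Submodule C.K (ARat C) :=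
  LinearMap.range (toDiffAlgebra (A := C.K)) ^ i

/-- `A^{(C,D)}_i = H^0(C, K(D)^{⊗ i})`: the rational `i`-differentials which near each point `P`
have the form `f (dt)^i`, where `t` is a uniformizer at `P` and `f` has at `P` a pole of order at
most `i δ_P`. -/
noncomputable def regDifferentials (C : ComplexCurve) (D : EffectiveDivisor C) (i : ℕ) :
    Submodule ℂ (ARat C) where
  carrier := {ω | ω ∈ C.ratDifferentials i ∧ ∀ (P : C.Point) (t : C.Stalk P.1),
    Ideal.span {t} = IsLocalRing.maximalIdeal (C.Stalk P.1) → ∃ f : C.K,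
      ω = f • toDiffAlgebra (KaehlerDifferential.D ℂ C.K (algebraMap _ C.K t)) ^ i ∧
      algebraMap _ C.K t ^ (i * D P) * f ∈ (algebraMap (C.Stalk P.1) C.K).range}
  zero_mem' := ⟨zero_mem _, fun P t _ => ⟨0, by simp, by simp⟩⟩
  add_mem' := by
    rintro a b ⟨ha, ha'⟩ ⟨hb, hb'⟩
    refine ⟨add_mem ha hb, fun P t ht => ?_⟩
    obtain ⟨f, hf, hf'⟩ := ha' P t ht
    obtain ⟨g, hg, hg'⟩ := hb' P t ht
    refine ⟨f + g, by rw [hf, hg, add_smul], ?_⟩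
    rw [mul_add]
    exact add_mem hf' hg'
  smul_mem' := by
    rintro c a ⟨ha, ha'⟩
    rw [← algebraMap_smul C.K c a]
    refine ⟨Submodule.smul_mem _ _ ha, fun P t ht => ?_⟩
    obtain ⟨f, hf, x, hx⟩ := ha' P t ht
    refine ⟨algebraMap ℂ C.K c * f, by rw [hf, smul_smul], algebraMap ℂ _ c * x, ?_⟩
    rw [map_mul, hx, ← IsScalarTower.algebraMap_apply]
    ring

/-- The rational differential `α` is inverse (dual) to the vector field `X`: `⟨X, α⟩ = 1`. -/
def IsInverse (X : Derivation ℂ C.K C.K) (α : Ω[C.K⁄ℂ]) : Prop :=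
  X.liftKaehlerDifferential α = 1

/-- The map `λ^{(i)}`, taking the class of `∑_{j ≥ i} a_j D_X^{-j}` modulo operators of degree
`≤ -i-1` to `a_i α^i`, where `α` is inverse to `X`. -/
noncomputable def principalSymbol {X : Derivation ℂ C.K C.K} (α : Ω[C.K⁄ℂ]) (i : ℕ)
    (b : BRat C X) : ARat C :=
  b.coeff i • toDiffAlgebra α ^ i

/-- The filtration induced on a subalgebra of `B_X^{rat}`. -/
noncomputable def inducedFiltration {X : Derivation ℂ C.K C.K} (S : Subalgebra ℂ (BRat C X)) (n : ℕ) :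
    Submodule ℂ S :=
  (PsiDO.filtration X n).comap S.val.toLinearMap

end ComplexCurve

/-- A decreasing exhaustive separated algebra filtration, complete for its topology. -/
structure IsCompleteFiltration {A : Type*} [Ring A] [Algebra ℂ A] (F : ℕ → Submodule ℂ A) :
    Prop where
  zero_eq_top : F 0 = ⊤
  antitone : Antitone F
  mul_mem : ∀ i j a b, a ∈ F i → b ∈ F j → a * b ∈ F (i + j)
  separated : ∀ a, (∀ n, a ∈ F n) → a = 0
  complete : ∀ s : ℕ → A, (∀ n, s (n + 1) - s n ∈ F n) → ∃ a, ∀ n, a - s n ∈ F n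

/-- `f` is a morphism of complete filtered algebras. -/
structure IsCompleteFilteredMorphism {A B : Type*} [Ring A] [Ring B] [Algebra ℂ A] [Algebra ℂ B]
    (F : ℕ → Submodule ℂ A) (G : ℕ → Submodule ℂ B) (f : A →ₐ[ℂ] B) : Prop where
  source : IsCompleteFiltration F
  target : IsCompleteFiltration G
  map_mem : ∀ n a, a ∈ F n → f a ∈ G n

open ComplexCurve in
/-- The filtered morphism `f : S' → S` quantizes the restriction `A' → A` of the classical pullback
`φ^*_class`: the maps `λ` send `gr_i(S')`, `gr_i(S)` to `A'_i`, `A_i`, the classical pullback sends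
`A'_i` to `A_i`, and `gr(f)` corresponds to `φ^*_class` under the maps `λ`. -/
structure QuantizesPullback {C C' : ComplexCurve} (φ : Covering C C')
    {X' : Derivation ℂ C'.K C'.K} {X : Derivation ℂ C.K C.K} (α' : Ω[C'.K⁄ℂ])
    {S' : Subalgebra ℂ (BRat C' X')} {S : Subalgebra ℂ (BRat C X)} (f : S' →ₐ[ℂ] S)
    (A' : ℕ → Submodule ℂ (ARat C')) (A : ℕ → Submodule ℂ (ARat C)) : Prop where
  symbol_source : ∀ i, ∀ b ∈ inducedFiltration S' i, principalSymbol α' i (b : BRat C' X') ∈ A' i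
  symbol_target : ∀ i, ∀ b ∈ inducedFiltration S i,
    principalSymbol (pullbackDifferential φ.pullback α') i (b : BRat C X) ∈ A i
  classical : ∀ i, ∀ ω ∈ A' i, pullbackClassical φ.pullback ω ∈ A i
  gr_eq : ∀ i, ∀ b ∈ inducedFiltration S' i,
    principalSymbol (pullbackDifferential φ.pullback α') i (f b : BRat C X) =
      pullbackClassical φ.pullback (principalSymbol α' i (b : BRat C' X'))

/-! Everything reduces to a computation of orders at one point. Let `t` be a uniformizer at `P` and
write X = (X(t)/t^δ) · t^δ d/dt. An operator satisfies the regularity condition at `P` for δ exactly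
when, after substituting D_X = (X(t)/t^δ) D_{t^δ d/dt}, its coefficients lie in the local ring
O_{C,P} (`laurentMap_mem_localRegular_iff`). This removes the formal coordinate: by
`changeDerivation_mem_localRegular_iff`, the derivation z^δ d/dz may be replaced by any v d/dz with
v of order δ, in particular by the expansion of t^δ d/dt. The inputs are that substitutions compose
(`changeDerivation_trans`) and commute with morphisms of differential rings
(`changeDerivation_map`).

The condition on X says that X extends X' along φ^* (`pullback_apply_of_isInverse`): both sides of
φ^*X' = Xφ^* are derivations on ℂ(C'), and such a derivation is determined by its value on a
uniformizer. Hence φ^* acts coefficientwise on operators.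

Let t' be a uniformizer at φ(P) and s = φ^*(t'). A regular operator at φ(P) pulls back to one with
coefficients in O_{C,P} with respect to s^{δ'} d/ds. Passing to t^δ d/dt is a substitution D_∂ = g
D_{∂'} with g⁻¹ = (ds/dt) t^δ / s^{δ'}. Since D_∂⁻¹ = D_{∂'}⁻¹ g⁻¹, it suffices that g⁻¹ is regular
(`changeDerivation_coeff_mem`). In characteristic zero its order is (ν - 1) + δ - νδ', which is
nonnegative for the prescribed δ (`param_ratio_mem`).

The classical statements use the same data. The leading coefficient a_i becomes a_i (t^δ/X(t))^i
under the substitution and α = dt/X(t), so regularity of an operator bounds the pole of its symbol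
a_i α^i. The i-th power of the ratio (ds/dt) t^δ / s^{δ'} controls the pullback of i-differentials.
Completeness passes to the regular operators because each substituted coefficient depends on
finitely many original ones. -/

namespace PsiDO

open Finset

/-! ### Composition, naturality and integrality of the substitution D_∂ = g D_{∂'}. -/

section Change

variable {k R : Type*} [CommRing k] [CommRing R] [Algebra k R] {d d' d'' : Derivation k R R}

theorem changeDerivation_coeff (g : Rˣ) (h : d = (g : R) • d') (a : PsiDO d) (n : ℕ) :
    (changeDerivation g h a).coeff n =
      ∑ j ∈ range (n + 1), a.coeff j * (eta d' g ^ j).coeff n := rfl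

theorem map_coeff {S : Type*} [CommRing S] [Algebra k S] {e : Derivation k S S} (ρ : R →ₐ[k] S)
    (h : ∀ r, ρ (d r) = e (ρ r)) (a : PsiDO d) (n : ℕ) :
    (map ρ h a).coeff n = ρ (a.coeff n) := rfl

theorem changeFun_const (g : Rˣ) (r : R) :
    changeFun d' g (const d r) = const d' r := by
  ext n
  change ∑ j ∈ range (n + 1), _ = _
  rw [sum_range_succ']
  simp [const, coeff_one]

/-- The substitution turns D_{∂'}⁻¹ g⁻¹ into D_{∂''}⁻¹ g'⁻¹ g⁻¹. Since substitution is
multiplicative, this one generator determines the composite of two substitutions. -/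
theorem changeDerivation_eta (g g' : Rˣ) (h' : d' = (g' : R) • d'') :
    changeDerivation g' h' (eta d' g) = eta d'' (g * g') := by
  change changeFun d'' g' (xi d' * const d' _) = _
  rw [changeFun_xi_mul g' h', changeFun_const, eta, eta, mul_assoc]
  congr 1
  ext n
  rw [const_mul_coeff]
  simp only [const]
  split_ifs <;> simp [mul_comm]

/-- Substituting `D_∂ = g D_{∂'}` and then `D_{∂'} = g' D_{∂''}` amounts to substituting
`D_∂ = g g' D_{∂''}`. -/
theorem changeDerivation_trans (g g' : Rˣ) (h : d = (g : R) • d') (h' : d' = (g' : R) • d'')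
    (h'' : d = ((g * g' : Rˣ) : R) • d'') (a : PsiDO d) :
    changeDerivation g' h' (changeDerivation g h a) = changeDerivation (g * g') h'' a := by
  ext n
  -- Only orders up to `n` matter, so the infinite series is replaced by a finite sum to which
  -- additivity and multiplicativity apply.
  have h1 : ∀ j ≤ n, (changeDerivation g h a).coeff j =
      (∑ i ∈ range (n + 1), a.coeff i • eta d' g ^ i).coeff j := fun j hj => by
    rw [sum_coeff]
    exact changeFun_coeff g a hj
  refine (changeFun_congr g' h1).trans ?_
  rw [changeFun_sum, sum_coeff, changeDerivation_coeff]
  refine sum_congr rfl fun i _ => ?_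
  rw [coeff_smul, smul_eq_mul, ← changeDerivation_eta g g' h', ← map_pow]
  rfl

theorem eta_one : eta d' (1 : Rˣ) = xi d' := by
  rw [eta, inv_one, Units.val_one, const_one, mul_one]

theorem xi_pow_coeff (j n : ℕ) : (xi d' ^ j).coeff n = if n = j then 1 else 0 := by
  induction j generalizing n with
  | zero => rw [pow_zero, coeff_one]
  | succ j ih =>
    rw [pow_succ']
    induction n with
    | zero => rw [xi_mul_coeff_zero, if_neg (by omega)]
    | succ n ihn =>
      rw [xi_mul_coeff_succ, ihn, ih]
      split_ifs <;> first | omega | simp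

theorem changeDerivation_one (h : d = ((1 : Rˣ) : R) • d) (a : PsiDO d) :
    changeDerivation 1 h a = a := by
  ext n
  rw [changeDerivation_coeff]
  simp [eta_one, xi_pow_coeff]

/-- The substitution attached to g⁻¹ is a left inverse, by transitivity. -/
theorem changeDerivation_injective (g : Rˣ) (h : d = (g : R) • d') :
    Function.Injective (changeDerivation g h) := by
  have h' : d' = ((g⁻¹ : Rˣ) : R) • d := by rw [h, smul_smul, Units.inv_mul, one_smul]
  have h1 : d = ((g * g⁻¹ : Rˣ) : R) • d := by simp
  have h2 : ∀ a, changeDerivation g⁻¹ h' (changeDerivation g h a) = a := fun a => by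
    rw [changeDerivation_trans g g⁻¹ h h' h1]
    have := changeDerivation_one (d := d) (by simp) a
    convert this
    simp
  exact Function.LeftInverse.injective h2

/-- In the recursion for the coefficients, the derivative term falls below the leading order and
vanishes, so each factor contributes just g⁻¹. -/
theorem eta_pow_coeff_self (g : Rˣ) (j : ℕ) :
    (eta d' g ^ j).coeff j = ((g⁻¹ : Rˣ) : R) ^ j := by
  induction j with
  | zero => simp [coeff_one]
  | succ j ih =>
    rw [eta_pow_coeff_succ, ih, eta_pow_coeff_of_lt g (Nat.lt_succ_self j), map_zero, sub_zero,
      pow_succ']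

/-- The leading coefficient of an operator after the substitution `D_∂ = g D_{∂'}`. -/
theorem changeDerivation_coeff_of_mem_filtration (g : Rˣ) (h : d = (g : R) • d') {n : ℕ}
    {a : PsiDO d} (ha : a ∈ filtration d n) :
    (changeDerivation g h a).coeff n = a.coeff n * ((g⁻¹ : Rˣ) : R) ^ n := by
  rw [changeDerivation_coeff, sum_range_succ, sum_eq_zero, zero_add, eta_pow_coeff_self]
  intro j hj
  rw [ha j (mem_range.1 hj), zero_mul]

/-- If `∂ = g ∂'` with `g⁻¹ ∈ O` and `∂'` preserves `O`, then the substitution `D_∂ = g D_{∂'}`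
preserves the operators with coefficients in `O`. -/
theorem changeDerivation_coeff_mem (O : Subalgebra k R) (hO : ∀ r ∈ O, d' r ∈ O) (g : Rˣ)
    (hg : ((g⁻¹ : Rˣ) : R) ∈ O) (h : d = (g : R) • d') {a : PsiDO d} (ha : ∀ n, a.coeff n ∈ O)
    (n : ℕ) : (changeDerivation g h a).coeff n ∈ O := by
  -- Only g⁻¹ enters D_∂⁻¹ = D_{∂'}⁻¹ g⁻¹, so `g` itself may have poles; this is what ramification
  -- requires.
  have h1 : eta d' g ∈ withCoeffsIn d' O hO := by
    refine mul_mem (fun j => ?_) (fun j => ?_)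
    · change (if j = 1 then (1 : R) else 0) ∈ O
      split_ifs
      exacts [O.one_mem, O.zero_mem]
    · change (if j = 0 then ((g⁻¹ : Rˣ) : R) else 0) ∈ O
      split_ifs
      exacts [hg, O.zero_mem]
  rw [changeDerivation_coeff]
  exact O.sum_mem fun j _ => O.mul_mem (ha j) (pow_mem h1 j n)

/-- Both sides are series in powers of the substituted inverse, and ρ carries D_{∂'}⁻¹ g⁻¹ to its
counterpart over `S`. -/
theorem changeDerivation_map {S : Type*} [CommRing S] [Algebra k S] {e e' : Derivation k S S}
    (ρ : R →ₐ[k] S) (hd : ∀ r, ρ (d r) = e (ρ r)) (hd' : ∀ r, ρ (d' r) = e' (ρ r)) (g : Rˣ)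
    (h : d = (g : R) • d') (g' : Sˣ) (hg : (g' : S) = ρ g) (h' : e = (g' : S) • e')
    (a : PsiDO d) :
    changeDerivation g' h' (map ρ hd a) = map ρ hd' (changeDerivation g h a) := by
  obtain rfl : g' = Units.map (ρ : R →* S) g := Units.ext hg
  have h1 : map ρ hd' (eta d' g) = eta e' (Units.map (ρ : R →* S) g) := by
    rw [eta, eta, map_mul]
    congr 1
    · ext n
      rw [map_coeff]
      simp only [xi]
      split_ifs <;> simp
    · ext n
      rw [map_coeff]
      simp only [const]
      split_ifs
      · rw [← map_inv]
        rfl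
      · simp
  ext n
  rw [map_coeff, changeDerivation_coeff, changeDerivation_coeff, map_sum]
  refine sum_congr rfl fun j _ => ?_
  rw [map_mul, map_coeff, ← h1, ← map_pow, map_coeff]

/-- The substitution is triangular for the order filtration. Consequently conditions on substituted
coefficients are closed under limits. -/
theorem changeDerivation_coeff_congr (g : Rˣ) (h : d = (g : R) • d') {n : ℕ} {a b : PsiDO d}
    (hab : b - a ∈ filtration d (n + 1)) :
    (changeDerivation g h b).coeff n = (changeDerivation g h a).coeff n :=
  changeFun_congr g fun j hj => sub_eq_zero.1 (hab j (by omega))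

end Change

/-! ### Completeness of the filtration by order. -/

section Filtration

variable {R : Type*} [CommRing R] [Algebra ℂ R] (d : Derivation ℂ R R)

theorem isCompleteFiltration_filtration : IsCompleteFiltration (filtration d) where
  zero_eq_top := by
    refine eq_top_iff.2 fun a _ j hj => ?_
    omega
  antitone m n hmn a ha j hj := ha j (by omega)
  mul_mem i j a b ha hb n hn := by
    rw [coeff_mul]
    refine sum_eq_zero fun p hp => sum_eq_zero fun q hq => ?_
    rw [HasAntidiagonal.mem_antidiagonal] at hp hq
    by_cases hpi : p.1 < i
    · rw [ha _ hpi, zero_mul, smul_zero]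
    · rw [hb q.1 (by omega), iterate_map_zero, mul_zero, smul_zero]
  separated a ha := by
    ext n
    exact ha (n + 1) n (by omega)
  complete s hs := by
    -- The differences `s (n + 1) - s n` have no coefficients below `n`, so the `j`-th coefficient
    -- is stable from index `j + 1` onwards.
    refine ⟨⟨fun n => (s (n + 1)).coeff n⟩, fun n j hj => ?_⟩
    rw [coeff_sub]
    refine sub_eq_zero.2 ?_
    induction n, (show j + 1 ≤ n by omega) using Nat.le_induction with
    | base => rfl
    | succ n hn ih =>
      rw [ih (by omega)]
      exact (sub_eq_zero.1 (hs n j (by omega))).symm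

end Filtration

end PsiDO

/-! ### Orders of Laurent series and independence of the local condition from the parameter. -/

section LaurentSeriesOrder

theorem laurent_smul_smul (f g : ℂ⸨X⸩) (d : Derivation ℂ ℂ⸨X⸩ ℂ⸨X⸩) :
    f • g • d = (f * g) • d :=
  Derivation.ext fun x => (mul_assoc f g (d x)).symm

theorem mem_laurentIntegers_iff_order (f : ℂ⸨X⸩) : f ∈ laurentIntegers ↔ 0 ≤ f.order := by
  rw [mem_laurentIntegers]
  constructor
  · intro h
    by_contra hlt
    rw [not_le] at hlt
    have h0 := HahnSeries.coeff_order_eq_zero.1 (h _ hlt)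
    rw [h0, HahnSeries.order_zero] at hlt
    exact lt_irrefl _ hlt
  · exact fun h n hn => HahnSeries.coeff_eq_zero_of_lt_order (by omega)

theorem laurent_order_div {f g : ℂ⸨X⸩} (hf : f ≠ 0) (hg : g ≠ 0) :
    (f / g).order = f.order - g.order := by
  have h := HahnSeries.order_mul (div_ne_zero hf hg) hg
  rw [div_mul_cancel₀ _ hg] at h
  omega

theorem laurent_order_pow (f : ℂ⸨X⸩) (n : ℕ) : (f ^ n).order = n * f.order := by
  rw [HahnSeries.order_pow, nsmul_eq_mul]

/-- The leading term is multiplied by the order, which is nonzero in ℂ. This use of characteristic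
zero gives ds/dt order exactly ν - 1. -/
theorem laurentDeriv_order {f : ℂ⸨X⸩} (hf : f ≠ 0) (h : f.order ≠ 0) :
    laurentDeriv f ≠ 0 ∧ (laurentDeriv f).order = f.order - 1 := by
  have h1 : (laurentDeriv f).coeff (f.order - 1) ≠ 0 := by
    rw [laurentDeriv_coeff, sub_add_cancel]
    refine mul_ne_zero ?_ fun h0 => hf (HahnSeries.coeff_order_eq_zero.1 h0)
    push_cast
    simpa using h
  have h2 : laurentDeriv f ≠ 0 := fun h0 => h1 (by rw [h0, HahnSeries.coeff_zero])
  refine ⟨h2, le_antisymm (HahnSeries.order_le_of_coeff_ne_zero h1) ?_⟩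
  rw [HahnSeries.le_order_iff_forall h2]
  intro n hn
  rw [laurentDeriv_coeff, HahnSeries.coeff_eq_zero_of_lt_order (by omega), mul_zero]

theorem zPow_val (δ : ℕ) : (zPow δ : ℂ⸨X⸩) = HahnSeries.single (1 : ℤ) (1 : ℂ) ^ δ := by
  simp [zPow]

theorem zPow_order (δ : ℕ) : (zPow δ : ℂ⸨X⸩).order = δ := by
  rw [zPow_val, laurent_order_pow, HahnSeries.order_single one_ne_zero, mul_one]

theorem laurentDerivPow_eq (δ : ℕ) : laurentDerivPow δ = (zPow δ : ℂ⸨X⸩) • laurentDeriv := by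
  rw [zPow_val, laurentDerivPow]

/-- For `e = v d/dz` with `v` of order `δ`, the operators in
`PsiDO(ℂ[[z]], z^δ d/dz)_{≤ 0}` are those with coefficients in `ℂ[[z]]` when expanded in powers
of `D_e`. -/
theorem changeDerivation_mem_localRegular_iff (δ : ℕ) {e : Derivation ℂ ℂ⸨X⸩ ℂ⸨X⸩}
    (v : ℂ⸨X⸩ˣ) (hv : (v : ℂ⸨X⸩).order = δ) (he : e = (v : ℂ⸨X⸩) • laurentDeriv) (a : PsiDO e) :
    PsiDO.changeDerivation v he a ∈ localRegular δ ↔ ∀ n, a.coeff n ∈ laurentIntegers := by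
  have hvz : e = ((v * (zPow δ)⁻¹ : ℂ⸨X⸩ˣ) : ℂ⸨X⸩) • laurentDerivPow δ := by
    rw [laurentDerivPow_eq, laurent_smul_smul, ← Units.val_mul, inv_mul_cancel_right, he]
  have hzv : laurentDerivPow δ = ((zPow δ * v⁻¹ : ℂ⸨X⸩ˣ) : ℂ⸨X⸩) • e := by
    rw [laurentDerivPow_eq, he, laurent_smul_smul, ← Units.val_mul, inv_mul_cancel_right]
  have h1 : ((v * (zPow δ)⁻¹ : ℂ⸨X⸩ˣ) : ℂ⸨X⸩) ∈ laurentIntegers := by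
    rw [mem_laurentIntegers_iff_order, Units.val_mul, Units.val_inv_eq_inv_val, ← div_eq_mul_inv,
      laurent_order_div v.ne_zero (Units.ne_zero _), zPow_order, hv, sub_self]
  have h2 : ((zPow δ * v⁻¹ : ℂ⸨X⸩ˣ) : ℂ⸨X⸩) ∈ laurentIntegers := by
    rw [mem_laurentIntegers_iff_order, Units.val_mul, Units.val_inv_eq_inv_val, ← div_eq_mul_inv,
      laurent_order_div (Units.ne_zero _) v.ne_zero, zPow_order, hv, sub_self]
  have hO := laurentDerivPow_mem δ
  have hOe : ∀ r ∈ laurentIntegers, e r ∈ laurentIntegers := fun r hr => by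
    rw [hvz]
    exact laurentIntegers.mul_mem h1 (hO r hr)
  constructor
  · rintro ⟨c, hc, hca⟩
    have h3 : PsiDO.changeDerivation v he (PsiDO.changeDerivation _ hzv c) =
        PsiDO.changeDerivation v he a := by
      refine Eq.trans ?_ hca
      refine (PsiDO.changeDerivation_trans _ _ hzv he (by
        rw [inv_mul_cancel_right]; exact laurentDerivPow_eq δ) c).trans ?_
      simp only [inv_mul_cancel_right]
      rfl
    rw [← PsiDO.changeDerivation_injective v he h3]
    exact PsiDO.changeDerivation_coeff_mem laurentIntegers hOe _ (by
      simpa [mul_comm] using h1) hzv hc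
  · intro ha
    refine ⟨PsiDO.changeDerivation _ hvz a, ?_, ?_⟩
    · exact PsiDO.changeDerivation_coeff_mem laurentIntegers hO _ (by
        simpa [mul_comm] using h2) hvz ha
    · refine (PsiDO.changeDerivation_trans _ _ hvz (laurentDerivPow_eq δ) (by
        rw [inv_mul_cancel_right]; exact he) a).trans ?_
      simp only [inv_mul_cancel_right]

end LaurentSeriesOrder

/-! ### Algebraic uniformizers and regularity of operators at a point. -/

namespace ComplexCurve

variable {C : ComplexCurve}

/-- The local ring `O_{C,x}` as a subalgebra of `ℂ(C)`. -/
noncomputable def stalkSubalgebra (x : C.scheme) : Subalgebra ℂ C.K :=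
  (IsScalarTower.toAlgHom ℂ (C.Stalk x) C.K).range

theorem algebraMap_mem_stalkSubalgebra {x : C.scheme} (f : C.Stalk x) :
    algebraMap (C.Stalk x) C.K f ∈ stalkSubalgebra x := ⟨f, rfl⟩

/-- The vector field `t^δ d/dt`, written as a multiple of `X`. -/
noncomputable def paramDeriv (X : Derivation ℂ C.K C.K) (t : C.K) (δ : ℕ) :
    Derivation ℂ C.K C.K := (t ^ δ / X t) • X

theorem paramDeriv_apply (X : Derivation ℂ C.K C.K) (t : C.K) (δ : ℕ) (f : C.K) :
    paramDeriv X t δ f = t ^ δ / X t * X f := rfl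

/-- The factor `X(t) / t^δ` with `X = (X(t) / t^δ) t^δ d/dt`. -/
noncomputable def paramFactor {X : Derivation ℂ C.K C.K} {t : C.K} (ht : t ≠ 0) (hX : X t ≠ 0)
    (δ : ℕ) : C.Kˣ := Units.mk0 (X t / t ^ δ) (div_ne_zero hX (pow_ne_zero δ ht))

theorem eq_paramFactor_smul {X : Derivation ℂ C.K C.K} {t : C.K} (ht : t ≠ 0) (hX : X t ≠ 0)
    (δ : ℕ) : X = (paramFactor ht hX δ : C.K) • paramDeriv X t δ := by
  rw [paramDeriv, smul_smul, paramFactor, Units.val_mk0, div_mul_div_cancel₀ (pow_ne_zero δ ht),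
    div_self hX, one_smul]

namespace LocalCoordinate

variable {P : C.Point} (z : LocalCoordinate P)

theorem mem_stalkSubalgebra_iff (f : C.K) :
    f ∈ stalkSubalgebra P.1 ↔ 0 ≤ (z.expand f).order := by
  rw [← mem_laurentIntegers_iff_order, ← z.mem_stalk_iff]
  rfl

theorem order_nonneg (f : C.Stalk P.1) : 0 ≤ (z.expand (algebraMap _ C.K f)).order :=
  (z.mem_stalkSubalgebra_iff _).1 (algebraMap_mem_stalkSubalgebra f)

include z in
-- In the decomposition f = c + t h of an element of the maximal ideal, the constant c is a nonunit,
-- hence zero.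
theorem exists_span_eq_maximalIdeal :
    ∃ t : C.Stalk P.1, Ideal.span {t} = IsLocalRing.maximalIdeal (C.Stalk P.1) := by
  obtain ⟨t, -, htm, H⟩ := z.exists_uniformizer
  refine ⟨t, le_antisymm ((Ideal.span_singleton_le_iff_mem _).2 htm) fun f hf => ?_⟩
  obtain ⟨c, h, rfl⟩ := H f
  have h1 : algebraMap ℂ (C.Stalk P.1) c ∈ IsLocalRing.maximalIdeal (C.Stalk P.1) :=
    ((IsLocalRing.maximalIdeal _).add_mem_iff_left (Ideal.mul_mem_right h _ htm)).1 hf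
  have h2 : c = 0 := by
    by_contra hc
    exact h1 ((IsUnit.mk0 c hc).map _)
  rw [h2, map_zero, zero_add]
  exact Ideal.mem_span_singleton.2 (dvd_mul_right t h)

variable {t : C.Stalk P.1} (ht : Ideal.span {t} = IsLocalRing.maximalIdeal (C.Stalk P.1))
include z ht

/-- The generator `t` divides an element of order one, so its order is 0 or 1. Order 0 would put the
inverse of `t` in the local ring. -/
theorem order_eq_one : (z.expand (algebraMap _ C.K t)).order = 1 := by
  obtain ⟨t0, h0, htm, -⟩ := z.exists_uniformizer
  rw [← ht, Ideal.mem_span_singleton] at htm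
  obtain ⟨h, rfl⟩ := htm
  have hne : z.expand (algebraMap _ C.K (t * h)) ≠ 0 := by
    intro h1
    rw [h1, HahnSeries.order_zero] at h0
    exact zero_ne_one h0
  rw [map_mul, map_mul] at h0 hne
  rw [HahnSeries.order_mul (left_ne_zero_of_mul hne) (right_ne_zero_of_mul hne)] at h0
  have h1 := z.order_nonneg t
  have h2 := z.order_nonneg h
  have h3 : (z.expand (algebraMap _ C.K t)).order ≠ 0 := fun h3 => by
    have h4 : algebraMap _ C.K t ≠ 0 := fun h4 => left_ne_zero_of_mul hne (by rw [h4, map_zero])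
    have h5 : (algebraMap _ C.K t)⁻¹ ∈ stalkSubalgebra P.1 := by
      rw [z.mem_stalkSubalgebra_iff, ← one_div, map_div₀, map_one,
        laurent_order_div one_ne_zero (left_ne_zero_of_mul hne), h3, HahnSeries.order_one, sub_zero]
    obtain ⟨u, hu⟩ := h5
    have h6 : t * u = 1 := IsFractionRing.injective (C.Stalk P.1) C.K (by
      rw [map_mul, map_one]
      refine (congrArg _ hu).trans (mul_inv_cancel₀ h4))
    have h7 : t ∈ IsLocalRing.maximalIdeal (C.Stalk P.1) := ht ▸ Ideal.mem_span_singleton_self t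
    exact h7 (IsUnit.of_mul_eq_one _ h6)
  omega

theorem expand_ne_zero : z.expand (algebraMap _ C.K t) ≠ 0 := fun h => by
  have h1 := z.order_eq_one ht
  rw [h, HahnSeries.order_zero] at h1
  exact zero_ne_one h1

theorem param_ne_zero : algebraMap (C.Stalk P.1) C.K t ≠ 0 := fun h =>
  z.expand_ne_zero ht (by rw [h, map_zero])

theorem derivation_eq_zero_of_param {L : Type*} [Field L] [Algebra ℂ L] [Algebra C.K L]
    [IsScalarTower ℂ C.K L] (δ : Derivation ℂ C.K L) (hδ : δ (algebraMap _ C.K t) = 0) :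
    δ = 0 := by
  obtain ⟨t0, h0, htm, H⟩ := z.exists_uniformizer
  rw [← ht, Ideal.mem_span_singleton] at htm
  obtain ⟨u, rfl⟩ := htm
  exact derivation_eq_zero t (ht ▸ Ideal.mem_span_singleton_self t)
    (fun f => let ⟨c, h, hh⟩ := H f; ⟨c, u * h, by rw [hh, mul_assoc]⟩) δ hδ

variable {X : Derivation ℂ C.K C.K} (hX : X ≠ 0)
include hX

theorem apply_param_ne_zero : X (algebraMap _ C.K t) ≠ 0 := fun h =>
  hX (z.derivation_eq_zero_of_param ht X h)

omit ht in
-- The factor X(z) cancels: the quotient is df/ds, independent of the vector field.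
theorem expand_apply_div_apply (f s : C.K) : z.expand (X f / X s) =
    laurentDeriv (z.expand f) / laurentDeriv (z.expand s) := by
  have h := (z.exists_localFactor X hX).choose_spec
  rw [map_div₀, h, h]
  exact mul_div_mul_left _ _ (Units.ne_zero _)

omit hX in
theorem laurentDeriv_param :
    laurentDeriv (z.expand (algebraMap _ C.K t)) ≠ 0 ∧
      (laurentDeriv (z.expand (algebraMap _ C.K t))).order = 0 := by
  have h := laurentDeriv_order (z.expand_ne_zero ht) (by rw [z.order_eq_one ht]; exact one_ne_zero)
  rw [z.order_eq_one ht, sub_self] at h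
  exact h

/-- The expansion of df/dt is a quotient of an integral series by the derivative of the expansion of
`t`, which has order zero. -/
theorem paramDeriv_mem (δ : ℕ) (f : C.K) (hf : f ∈ stalkSubalgebra P.1) :
    paramDeriv X (algebraMap _ C.K t) δ f ∈ stalkSubalgebra P.1 := by
  have h1 : X f / X (algebraMap _ C.K t) ∈ stalkSubalgebra P.1 := by
    rw [z.mem_stalkSubalgebra_iff, z.expand_apply_div_apply hX]
    by_cases h0 : laurentDeriv (z.expand f) = 0
    · rw [h0, zero_div, HahnSeries.order_zero]
    · rw [laurent_order_div h0 (z.laurentDeriv_param ht).1, (z.laurentDeriv_param ht).2, sub_zero]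
      have h2 := laurentDerivPow_mem 0 (z.expand f) (by
        rwa [mem_laurentIntegers_iff_order, ← z.mem_stalkSubalgebra_iff])
      rw [← mem_laurentIntegers_iff_order]
      simpa [laurentDerivPow] using h2
  rw [paramDeriv_apply, div_mul_eq_mul_div, mul_div_assoc]
  exact mul_mem (pow_mem (algebraMap_mem_stalkSubalgebra t) δ) h1

/-- Regularity of an operator at `P` in terms of a uniformizer `t`: its coefficients in powers of
the inverse of `D_{t^δ d/dt}` belong to the local ring. -/
theorem laurentMap_mem_localRegular_iff (δ : ℕ) (b : BRat C X) :
    z.laurentMap hX b ∈ localRegular δ ↔ ∀ n, (PsiDO.changeDerivation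
      (paramFactor (z.param_ne_zero ht) (z.apply_param_ne_zero ht hX) δ)
      (eq_paramFactor_smul _ _ δ) b).coeff n ∈ stalkSubalgebra P.1 := by
  set τ := algebraMap _ C.K t with hτ
  set T := z.expand τ with hT
  have hT0 : T ≠ 0 := z.expand_ne_zero ht
  obtain ⟨hdT, hdT'⟩ := z.laurentDeriv_param ht
  have hT1 : T.order = 1 := z.order_eq_one ht
  -- Here v d/dz is the expansion of t^δ d/dt; it has order δ because T has order 1 and T' order 0.
  set v : ℂ⸨X⸩ˣ := Units.mk0 (T ^ δ / laurentDeriv T) (div_ne_zero (pow_ne_zero δ hT0) hdT) with hv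
  set g := paramFactor (z.param_ne_zero ht) (z.apply_param_ne_zero ht hX) δ with hg
  set g' : ℂ⸨X⸩ˣ := Units.map (z.expand : C.K →* ℂ⸨X⸩) g with hg'
  have hspec : ∀ f, z.expand (X f) =
      ((z.localFactor hX : ℂ⸨X⸩) • laurentDeriv) (z.expand f) :=
    (z.exists_localFactor X hX).choose_spec
  have hvo : (v : ℂ⸨X⸩).order = δ := by
    rw [hv, Units.val_mk0, laurent_order_div (pow_ne_zero δ hT0) hdT, hdT', laurent_order_pow, hT1]
    simp
  have hfac : g' * v = z.localFactor hX := by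
    refine Units.ext ?_
    rw [Units.val_mul, hg', hv, Units.val_mk0]
    change z.expand (X τ / τ ^ δ) * _ = _
    rw [map_div₀, map_pow, hspec, div_mul_div_cancel₀ (pow_ne_zero δ hT0)]
    exact mul_div_cancel_right₀ _ hdT
  have he : ∀ f, z.expand (paramDeriv X τ δ f) = ((v : ℂ⸨X⸩) • laurentDeriv) (z.expand f) := by
    intro f
    rw [paramDeriv_apply, div_mul_eq_mul_div, mul_div_assoc, map_mul,
      z.expand_apply_div_apply hX, map_pow]
    change T ^ δ * (_ / _) = T ^ δ / laurentDeriv T * _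
    rw [← mul_div_assoc, div_mul_eq_mul_div]
    rfl
  have hsm : (z.localFactor hX : ℂ⸨X⸩) • laurentDeriv = (g' : ℂ⸨X⸩) • (v : ℂ⸨X⸩) • laurentDeriv := by
    rw [laurent_smul_smul, ← Units.val_mul, hfac]
  -- The Laurent map is factored through the algebraic substitution over ℂ(C), by moving the factor
  -- X(t)/t^δ across the expansion.
  have h1 : z.laurentMap hX b = PsiDO.changeDerivation v rfl
      (PsiDO.map z.expand he (PsiDO.changeDerivation g (eq_paramFactor_smul _ _ δ) b)) := by
    rw [← PsiDO.changeDerivation_map z.expand hspec he g (eq_paramFactor_smul _ _ δ) g' rfl hsm,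
      PsiDO.changeDerivation_trans g' v hsm rfl (by rw [hfac])]
    simp only [hfac]
    rfl
  rw [h1, changeDerivation_mem_localRegular_iff δ v hvo rfl]
  refine forall_congr' fun n => ?_
  rw [PsiDO.map_coeff, mem_laurentIntegers_iff_order, z.mem_stalkSubalgebra_iff]

end LocalCoordinate

end ComplexCurve

/-! ### Functoriality of differentials and of their symmetric algebra. -/

section PullbackDifferentials

variable {A B : Type*} [CommRing A] [CommRing B] [Algebra ℂ A] [Algebra ℂ B]

theorem pullbackDifferential_smul_D (φ : A →ₐ[ℂ] B) (f g : A) :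
    pullbackDifferential φ (f • KaehlerDifferential.D ℂ A g) =
      φ f • KaehlerDifferential.D ℂ B (φ g) := by
  let _ := φ.toRingHom.toAlgebra
  have : IsScalarTower ℂ A B := IsScalarTower.of_algebraMap_eq fun c => (φ.commutes c).symm
  change KaehlerDifferential.map ℂ ℂ A B _ = _
  rw [map_smul, KaehlerDifferential.map_D]
  rfl

theorem pullbackClassical_smul (φ : A →ₐ[ℂ] B) (f : A) (ω : DiffAlgebra A) :
    pullbackClassical φ (f • ω) = φ f • pullbackClassical φ ω := by
  let _ := φ.toRingHom.toAlgebra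
  have : IsScalarTower ℂ A B := IsScalarTower.of_algebraMap_eq fun c => (φ.commutes c).symm
  change SymmetricAlgebra.lift (R := A) _ _ = _ • SymmetricAlgebra.lift (R := A) _ _
  rw [map_smul]
  exact (algebraMap_smul B f _).symm

theorem pullbackClassical_toDiffAlgebra (φ : A →ₐ[ℂ] B) (ω : Ω[A⁄ℂ]) :
    pullbackClassical φ (toDiffAlgebra ω) = toDiffAlgebra (pullbackDifferential φ ω) := by
  let _ := φ.toRingHom.toAlgebra
  have : IsScalarTower ℂ A B := IsScalarTower.of_algebraMap_eq fun c => (φ.commutes c).symm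
  exact SymmetricAlgebra.lift_ι_apply ..

end PullbackDifferentials

/-! ### The algebras of regular operators and their principal symbols. -/

namespace ComplexCurve

variable {C C' : ComplexCurve}

/-- A nonempty quasi-compact scheme has a closed point. One point suffices for arguments about ℂ(C)
that need a uniformizer. -/
theorem nonempty_point (C : ComplexCurve) : Nonempty C.Point := by
  have : CompactSpace C.scheme :=
    QuasiCompact.compactSpace_of_compactSpace C.toBase
  obtain ⟨x, -, hx⟩ := isClosed_univ.exists_closed_singleton (X := C.scheme) Set.univ_nonempty
  exact ⟨⟨x, hx⟩⟩

theorem mem_BReg_iff {z : ∀ P : C.Point, LocalCoordinate P} {X : Derivation ℂ C.K C.K}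
    {hX : X ≠ 0} {D : EffectiveDivisor C} {b : BRat C X} :
    b ∈ BReg z hX D ↔ ∀ P, (z P).laurentMap hX b ∈ localRegular (D P) := by
  rw [BReg, Algebra.mem_iInf]
  rfl

theorem isCompleteFiltration_inducedFiltration (z : ∀ P : C.Point, LocalCoordinate P)
    {X : Derivation ℂ C.K C.K} (hX : X ≠ 0) (D : EffectiveDivisor C) :
    IsCompleteFiltration (inducedFiltration (BReg z hX D)) where
  zero_eq_top := by
    rw [inducedFiltration, (PsiDO.isCompleteFiltration_filtration X).zero_eq_top]
    rfl
  antitone m n hmn a ha := (PsiDO.isCompleteFiltration_filtration X).antitone hmn ha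
  mul_mem i j a b ha hb := (PsiDO.isCompleteFiltration_filtration X).mul_mem i j _ _ ha hb
  separated a ha := Subtype.ext ((PsiDO.isCompleteFiltration_filtration X).separated a ha)
  complete s hs := by
    obtain ⟨a, ha⟩ := (PsiDO.isCompleteFiltration_filtration X).complete (fun n => s n) hs
    refine ⟨⟨a, mem_BReg_iff.2 fun P => ?_⟩, ha⟩
    obtain ⟨t, ht⟩ := (z P).exists_span_eq_maximalIdeal
    rw [(z P).laurentMap_mem_localRegular_iff ht]
    intro n
    -- The limit agrees with `s (n + 1)` through order `n`, so its `n`-th substituted coefficient is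
    -- that of a regular operator.
    rw [PsiDO.changeDerivation_coeff_congr _ _ (ha (n + 1))]
    exact ((z P).laurentMap_mem_localRegular_iff ht hX _ _).1 (mem_BReg_iff.1 (s (n + 1)).2 P) n

namespace LocalCoordinate

variable {P : C.Point} (z : LocalCoordinate P) {t : C.Stalk P.1}
  (ht : Ideal.span {t} = IsLocalRing.maximalIdeal (C.Stalk P.1))
include z ht

/-- A linear form on differentials that kills dt corresponds to a derivation vanishing at `t`, hence
is zero. -/
theorem span_D_param :
    Submodule.span C.K {KaehlerDifferential.D ℂ C.K (algebraMap _ C.K t)} = ⊤ := by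
  by_contra h
  obtain ⟨f, hf, hle⟩ := Submodule.exists_le_ker_of_lt_top _ (lt_top_iff_ne_top.2 h)
  have h1 : f.compDer (KaehlerDifferential.D ℂ C.K) = 0 :=
    z.derivation_eq_zero_of_param ht _ (hle (Submodule.mem_span_singleton_self _))
  refine hf (LinearMap.ext_on_range (v := KaehlerDifferential.D ℂ C.K)
    (KaehlerDifferential.span_range_derivation ℂ C.K) fun g => ?_)
  exact DFunLike.congr_fun h1 g

variable {X : Derivation ℂ C.K C.K}

theorem eq_inv_smul_D_of_isInverse {α : Ω[C.K⁄ℂ]} (hα : IsInverse X α) :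
    α = (X (algebraMap _ C.K t))⁻¹ • KaehlerDifferential.D ℂ C.K (algebraMap _ C.K t) := by
  obtain ⟨c, rfl⟩ := Submodule.mem_span_singleton.1
    ((z.span_D_param ht).symm ▸ Submodule.mem_top (x := α))
  rw [IsInverse, map_smul, Derivation.liftKaehlerDifferential_comp_D, smul_eq_mul] at hα
  rw [eq_inv_of_mul_eq_one_left hα]

end LocalCoordinate

theorem principalSymbol_mem_ratDifferentials {X : Derivation ℂ C.K C.K} (α : Ω[C.K⁄ℂ]) (i : ℕ)
    (b : BRat C X) : principalSymbol α i b ∈ C.ratDifferentials i :=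
  Submodule.smul_mem _ _ (Submodule.pow_mem_pow _ (LinearMap.mem_range_self _ _) i)

/-- The principal symbol of a regular operator is a regular differential. -/
theorem principalSymbol_mem_regDifferentials (z : ∀ P : C.Point, LocalCoordinate P)
    {X : Derivation ℂ C.K C.K} (hX : X ≠ 0) {α : Ω[C.K⁄ℂ]} (hα : IsInverse X α)
    (D : EffectiveDivisor C) (i : ℕ) (b : BReg z hX D)
    (hb : b ∈ inducedFiltration (BReg z hX D) i) :
    principalSymbol α i (b : BRat C X) ∈ C.regDifferentials D i := by
  refine ⟨principalSymbol_mem_ratDifferentials _ _ _, fun P t ht => ?_⟩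
  have ht0 := (z P).param_ne_zero ht
  have hXt := (z P).apply_param_ne_zero ht hX
  -- This coefficient comes from α = X(t)⁻¹ dt. It differs from the substituted leading coefficient
  -- by t^{iδ}, exactly the allowed pole.
  refine ⟨(b : BRat C X).coeff i * ((X (algebraMap _ C.K t))⁻¹) ^ i, ?_, ?_⟩
  · rw [principalSymbol, (z P).eq_inv_smul_D_of_isInverse ht hα, map_smul, smul_pow, smul_smul]
  · have h := ((z P).laurentMap_mem_localRegular_iff ht hX _ _).1 (mem_BReg_iff.1 b.2 P) i
    rw [PsiDO.changeDerivation_coeff_of_mem_filtration _ _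
      (show (b : BRat C X) ∈ PsiDO.filtration X i from hb)] at h
    obtain ⟨f, hf⟩ := h
    refine ⟨f, hf.trans ?_⟩
    rw [paramFactor, Units.val_inv_eq_inv_val, Units.val_mk0, inv_div, div_pow, ← pow_mul,
      mul_comm (D P) i, inv_pow]
    ring

/-! ### Local rings and ramification along the covering. -/

namespace Covering

variable (φ : Covering C C')

theorem isLocalHom_stalkMap (x : C.scheme) : IsLocalHom (φ.hom.stalkMap x).hom :=
  inferInstance

/-- The morphism of local rings `O_{C',φ(P)} → O_{C,P}`. -/
noncomputable def stalkHom (P : C.Point) : C'.Stalk (φ.mapPoint P).1 →+* C.Stalk P.1 :=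
  (φ.hom.stalkMap P.1).hom

theorem isUnit_of_isUnit_stalkHom {P : C.Point} {f : C'.Stalk (φ.mapPoint P).1}
    (hf : IsUnit (φ.stalkHom P f)) : IsUnit f :=
  (φ.isLocalHom_stalkMap P.1).map_nonunit f hf

/-- Stalk maps commute with specialization from `P` to the generic point. -/
theorem pullback_algebraMap (P : C.Point) (f : C'.Stalk (φ.mapPoint P).1) :
    φ.pullback (algebraMap (C'.Stalk (φ.mapPoint P).1) C'.K f) =
      algebraMap (C.Stalk P.1) C.K (φ.stalkHom P f) := by
  have h := Scheme.Hom.stalkSpecializes_stalkMap φ.hom (genericPoint C.scheme) P.1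
    ((genericPoint_spec C.scheme).specializes trivial)
  have h1 := congrArg (fun g => g.hom f) h
  refine Eq.trans ?_ h1
  change ((C'.scheme.presheaf.stalkSpecializes _ ≫
      C'.scheme.presheaf.stalkSpecializes _ ≫ φ.hom.stalkMap (genericPoint C.scheme)).hom f) = _
  rw [← Category.assoc, TopCat.Presheaf.stalkSpecializes_comp]
  rfl

theorem pullback_mem_stalkSubalgebra (P : C.Point) {f : C'.K}
    (hf : f ∈ stalkSubalgebra (φ.mapPoint P).1) : φ.pullback f ∈ stalkSubalgebra P.1 := by
  obtain ⟨f, rfl⟩ := hf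
  exact ⟨_, (φ.pullback_algebraMap P f).symm⟩

section Ramification

variable {P : C.Point} (z : LocalCoordinate P) (z' : LocalCoordinate (φ.mapPoint P))
  {t' : C'.Stalk (φ.mapPoint P).1}
  (ht' : Ideal.span {t'} = IsLocalRing.maximalIdeal (C'.Stalk (φ.mapPoint P).1))
include z z' ht'

omit z in
theorem pullback_param_ne_zero : φ.pullback (algebraMap _ C'.K t') ≠ 0 :=
  (map_ne_zero φ.pullback).2 (z'.param_ne_zero ht')

/-- The stalk map is local, so it sends t' into the maximal ideal at `P`. -/
theorem one_le_order_pullback :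
    1 ≤ (z.expand (φ.pullback (algebraMap _ C'.K t'))).order := by
  obtain ⟨t, ht⟩ := z.exists_span_eq_maximalIdeal
  have h1 : t' ∈ IsLocalRing.maximalIdeal (C'.Stalk (φ.mapPoint P).1) :=
    ht' ▸ Ideal.mem_span_singleton_self t'
  have h2 : φ.stalkHom P t' ∈ IsLocalRing.maximalIdeal (C.Stalk P.1) :=
    fun h => h1 (φ.isUnit_of_isUnit_stalkHom h)
  have h0 := φ.pullback_param_ne_zero z' ht'
  rw [φ.pullback_algebraMap] at h0 ⊢
  rw [← ht, Ideal.mem_span_singleton] at h2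
  obtain ⟨u, hu⟩ := h2
  rw [hu, map_mul] at h0 ⊢
  rw [map_mul, HahnSeries.order_mul ((map_ne_zero z.expand).2 (left_ne_zero_of_mul h0))
    ((map_ne_zero z.expand).2 (right_ne_zero_of_mul h0)), z.order_eq_one ht]
  have := z.order_nonneg u
  omega

/-- The ramification index at `P` is the order at `P` of the pullback of a uniformizer. -/
theorem ramificationIndex_eq_order :
    (φ.ramificationIndex P : ℤ) = (z.expand (φ.pullback (algebraMap _ C'.K t'))).order := by
  obtain ⟨t, ht⟩ := z.exists_span_eq_maximalIdeal
  have h0 := φ.pullback_param_ne_zero z' ht'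
  obtain ⟨n, hn⟩ := Int.eq_ofNat_of_zero_le
    (zero_le_one.trans (φ.one_le_order_pullback z z' ht'))
  rw [hn]
  congr 1
  -- With principal maximal ideals, the inclusion of ideals says that t^k divides φ^*(t'), that is,
  -- φ^*(t')/t^k is regular at `P`.
  have hset : {k : ℕ | (IsLocalRing.maximalIdeal (C'.Stalk (φ.hom P.1))).map
      (φ.hom.stalkMap P.1).hom ≤ IsLocalRing.maximalIdeal (C.Stalk P.1) ^ k} = Set.Iic n := by
    ext k
    change (IsLocalRing.maximalIdeal (C'.Stalk (φ.mapPoint P).1)).map (φ.stalkHom P) ≤ _ ↔ k ≤ n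
    rw [← ht', Ideal.map_span, Set.image_singleton,
      Ideal.span_singleton_le_iff_mem, ← ht, Ideal.span_singleton_pow, Ideal.mem_span_singleton]
    have hpow : algebraMap _ C.K t ^ k ≠ 0 := pow_ne_zero k (z.param_ne_zero ht)
    have h1 : (z.expand (φ.pullback (algebraMap _ C'.K t') / algebraMap _ C.K t ^ k)).order =
        n - k := by
      rw [map_div₀, laurent_order_div ((map_ne_zero _).2 h0) ((map_ne_zero _).2 hpow), hn, map_pow,
        laurent_order_pow, z.order_eq_one ht, mul_one]
    have h2 : k ≤ n ↔ φ.pullback (algebraMap _ C'.K t') / algebraMap _ C.K t ^ k ∈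
        stalkSubalgebra P.1 := by
      rw [z.mem_stalkSubalgebra_iff, h1]
      omega
    rw [h2]
    constructor
    · rintro ⟨u, hu⟩
      refine ⟨u, ?_⟩
      rw [φ.pullback_algebraMap, eq_div_iff hpow]
      refine Eq.trans ?_ (congrArg (algebraMap _ C.K) hu).symm
      rw [map_mul, map_pow, mul_comm]
      rfl
    · rintro ⟨u, hu⟩
      refine ⟨u, IsFractionRing.injective (C.Stalk P.1) C.K ?_⟩
      refine (φ.pullback_algebraMap P t').symm.trans ?_
      rw [map_mul, map_pow, mul_comm]
      exact ((eq_div_iff hpow).1 hu).symm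
  rw [ramificationIndex, hset, csSup_Iic]

/-- With `s = φ^*(t')`, the factor `(ds/dt) t^δ / s^{δ'}` relating `t^δ d/dt` to
`s^{δ'} d/ds` is regular at `P`. -/
theorem param_ratio_mem {t : C.Stalk P.1}
    (ht : Ideal.span {t} = IsLocalRing.maximalIdeal (C.Stalk P.1))
    {X : Derivation ℂ C.K C.K} (hX : X ≠ 0) (δ' : ℕ) :
    X (φ.pullback (algebraMap _ C'.K t')) / X (algebraMap _ C.K t) *
      (algebraMap _ C.K t ^ (δ' * φ.ramificationIndex P - (φ.ramificationIndex P - 1)) /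
        φ.pullback (algebraMap _ C'.K t') ^ δ') ∈ stalkSubalgebra P.1 := by
  have h0 := φ.pullback_param_ne_zero z' ht'
  have h1 := φ.one_le_order_pullback z z' ht'
  have hν := φ.ramificationIndex_eq_order z z' ht'
  set s := φ.pullback (algebraMap _ C'.K t')
  set ν := φ.ramificationIndex P
  have hs0 := (map_ne_zero z.expand).2 h0
  obtain ⟨hd0, hd⟩ := laurentDeriv_order hs0 (by omega)
  obtain ⟨hT0, hT⟩ := z.laurentDeriv_param ht
  have htp := z.expand_ne_zero ht
  -- The order is (ν - 1) + δ - δ'ν. As ν ≥ 1, the inner truncated subtraction is exact, and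
  -- truncating the outer one can only increase δ.
  rw [z.mem_stalkSubalgebra_iff, map_mul, z.expand_apply_div_apply hX, map_div₀, map_pow, map_pow,
    HahnSeries.order_mul (div_ne_zero hd0 hT0) (div_ne_zero (pow_ne_zero _ htp)
      (pow_ne_zero _ hs0)), laurent_order_div hd0 hT0, laurent_order_div (pow_ne_zero _ htp)
      (pow_ne_zero _ hs0), laurent_order_pow, laurent_order_pow, hd, hT, z.order_eq_one ht, ← hν]
  have h2 : ((δ' * ν : ℕ) : ℤ) = δ' * ν := by push_cast; rfl
  rw [← h2]
  omega

end Ramification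

end Covering

/-- Used with a = ds/dt: the pole bound s^{iδ'} on C' is traded for t^{iδ} on C at the cost of the
i-th power of the regular ratio. -/
theorem ratio_pow_mul {F : Type*} [Field F] (a τ : F) {s : F} (hs : s ≠ 0) (y : F) (m n i : ℕ) :
    (a * (τ ^ m / s ^ n)) ^ i * (s ^ (i * n) * y) = τ ^ (i * m) * (y * a ^ i) := by
  rw [mul_pow, div_pow, mul_comm i n, mul_comm i m, pow_mul, pow_mul]
  have h : (s ^ n) ^ i ≠ 0 := pow_ne_zero _ (pow_ne_zero _ hs)
  field_simp

/-! ### Pullback of regular operators and of regular differentials. -/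

namespace Covering

variable (φ : Covering C C')

/-- If `⟨X, φ^*α'⟩ = 1 = ⟨X', α'⟩` then `X` extends `X'` along `φ^*`. -/
theorem pullback_apply_of_isInverse {P' : C'.Point} (z' : LocalCoordinate P')
    {X' : Derivation ℂ C'.K C'.K} (hX' : X' ≠ 0) {α' : Ω[C'.K⁄ℂ]} (hα' : IsInverse X' α')
    {X : Derivation ℂ C.K C.K} (hα : IsInverse X (pullbackDifferential φ.pullback α'))
    (f : C'.K) : φ.pullback (X' f) = X (φ.pullback f) := by
  obtain ⟨t, ht⟩ := z'.exists_span_eq_maximalIdeal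
  let _ : Algebra C'.K C.K := φ.pullback.toRingHom.toAlgebra
  have : IsScalarTower ℂ C'.K C.K :=
    IsScalarTower.of_algebraMap_eq fun c => (φ.pullback.commutes c).symm
  let δ : Derivation ℂ C'.K C.K := Derivation.mk'
    (φ.pullback.toLinearMap ∘ₗ X'.toLinearMap - X.toLinearMap ∘ₗ φ.pullback.toLinearMap)
    (fun a b => by
      change φ.pullback (X' (a * b)) - X (φ.pullback (a * b)) =
        φ.pullback a * (φ.pullback (X' b) - X (φ.pullback b)) +
        φ.pullback b * (φ.pullback (X' a) - X (φ.pullback a))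
      simp only [Derivation.leibniz, map_mul, map_add, smul_eq_mul]
      ring)
  have h0 : φ.pullback (X' (algebraMap _ C'.K t)) ≠ 0 :=
    (map_ne_zero φ.pullback).2 (z'.apply_param_ne_zero ht hX')
  -- Writing α' = X'(t)⁻¹ dt turns the duality condition into φ^*(X' t) = X(φ^* t), which is the
  -- vanishing of δ at the uniformizer.
  rw [z'.eq_inv_smul_D_of_isInverse ht hα', pullbackDifferential_smul_D, IsInverse, map_smul,
    Derivation.liftKaehlerDifferential_comp_D, map_inv₀, smul_eq_mul, inv_mul_eq_one₀ h0] at hα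
  have hδ : δ = 0 := z'.derivation_eq_zero_of_param ht δ (sub_eq_zero.2 hα)
  exact sub_eq_zero.1 (DFunLike.congr_fun hδ f)

variable {X' : Derivation ℂ C'.K C'.K} {X : Derivation ℂ C.K C.K}

/-- The pullback of operators preserves regularity. -/
theorem map_mem_BReg (z : ∀ P : C.Point, LocalCoordinate P)
    (z' : ∀ P' : C'.Point, LocalCoordinate P') (hX' : X' ≠ 0) (hX : X ≠ 0)
    (h : ∀ f, φ.pullback (X' f) = X (φ.pullback f)) (D' : EffectiveDivisor C')
    {b : BRat C' X'} (hb : b ∈ BReg z' hX' D') :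
    PsiDO.map φ.pullback h b ∈ BReg z hX (φ.preimage D') := by
  refine mem_BReg_iff.2 fun P => ?_
  obtain ⟨t, ht⟩ := (z P).exists_span_eq_maximalIdeal
  obtain ⟨t', ht'⟩ := (z' (φ.mapPoint P)).exists_span_eq_maximalIdeal
  rw [(z P).laurentMap_mem_localRegular_iff ht hX]
  have hb' := ((z' _).laurentMap_mem_localRegular_iff ht' hX' _ _).1
    (mem_BReg_iff.1 hb (φ.mapPoint P))
  have ht0 := (z P).param_ne_zero ht
  have ht0' := (z' _).param_ne_zero ht'
  have hXt := (z P).apply_param_ne_zero ht hX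
  have hXt' := (z' _).apply_param_ne_zero ht' hX'
  set τ := algebraMap _ C.K t
  set τ' := algebraMap _ C'.K t' with hτ'
  set s := φ.pullback τ' with hs
  have hs0 : s ≠ 0 := φ.pullback_param_ne_zero (z' _) ht'
  have hXs : X s ≠ 0 := by
    rw [hs, ← h]
    exact (map_ne_zero φ.pullback).2 hXt'
  set δ' := D' (φ.mapPoint P)
  set δ := φ.preimage D' P with hδ
  set g := paramFactor ht0 hXt δ
  set g' := paramFactor ht0' hXt' δ'
  set q := paramFactor hs0 hXs δ'
  have hq : X = (q : C.K) • paramDeriv X s δ' := eq_paramFactor_smul _ _ _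
  have hg : X = (g : C.K) • paramDeriv X τ δ := eq_paramFactor_smul _ _ _
  have hw : paramDeriv X s δ' = ((q⁻¹ * g : C.Kˣ) : C.K) • paramDeriv X τ δ := by
    ext f
    have h1 : X f = g * paramDeriv X τ δ f := DFunLike.congr_fun hg f
    have h2 : X f = q * paramDeriv X s δ' f := DFunLike.congr_fun hq f
    change _ = ((q⁻¹ * g : C.Kˣ) : C.K) * paramDeriv X τ δ f
    rw [Units.val_mul, mul_assoc, ← h1, h2, Units.inv_mul_cancel_left]
  have hpar : ∀ f, φ.pullback (paramDeriv X' τ' δ' f) = paramDeriv X s δ' (φ.pullback f) := by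
    intro f
    rw [paramDeriv_apply, paramDeriv_apply, map_mul, map_div₀, map_pow, h, h]
  have hqg : (q : C.K) = φ.pullback g' := by
    change X s / s ^ δ' = φ.pullback (X' τ' / τ' ^ δ')
    rw [map_div₀, map_pow, h]
  -- The passage from X to t^δ d/dt is split through s^{δ'} d/ds; its first half is the pullback of
  -- the corresponding substitution on C'.
  have key : PsiDO.changeDerivation g hg (PsiDO.map φ.pullback h b) =
      PsiDO.changeDerivation (q⁻¹ * g) hw (PsiDO.map φ.pullback hpar
        (PsiDO.changeDerivation g' (eq_paramFactor_smul ht0' hXt' δ') b)) := by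
    rw [← PsiDO.changeDerivation_map φ.pullback h hpar g' _ q hqg hq,
      PsiDO.changeDerivation_trans q (q⁻¹ * g) hq hw (by rw [mul_inv_cancel_left]; exact hg)]
    simp only [mul_inv_cancel_left]
  rw [key]
  refine PsiDO.changeDerivation_coeff_mem _ ((z P).paramDeriv_mem ht hX δ) _ ?_ hw fun n => ?_
  -- The inverse of `q⁻¹ * g` is the ratio (ds/dt) t^δ / s^{δ'}.
  · have h3 := φ.param_ratio_mem (z P) (z' _) ht' ht hX δ'
    convert h3 using 1
    rw [mul_inv_rev, inv_inv, Units.val_mul, Units.val_inv_eq_inv_val]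
    change (X τ / τ ^ δ)⁻¹ * (X s / s ^ δ') = X s / X τ * (τ ^ δ / s ^ δ')
    rw [inv_div]
    ring
  · exact φ.pullback_mem_stalkSubalgebra P (hb' n)

/-- The classical pullback maps regular differentials to regular differentials. -/
theorem pullbackClassical_mem_regDifferentials (z : ∀ P : C.Point, LocalCoordinate P)
    (z' : ∀ P' : C'.Point, LocalCoordinate P') (hX' : X' ≠ 0) (hX : X ≠ 0)
    {α' : Ω[C'.K⁄ℂ]} (hα' : IsInverse X' α')
    (hα : IsInverse X (pullbackDifferential φ.pullback α')) (D' : EffectiveDivisor C') (i : ℕ)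
    {ω : ARat C'} (hω : ω ∈ C'.regDifferentials D' i) :
    pullbackClassical φ.pullback ω ∈ C.regDifferentials (φ.preimage D') i := by
  have hpull : ∀ (P : C.Point) (t : C.Stalk P.1),
      Ideal.span {t} = IsLocalRing.maximalIdeal (C.Stalk P.1) → ∃ f : C.K,
      pullbackClassical φ.pullback ω =
        f • toDiffAlgebra (KaehlerDifferential.D ℂ C.K (algebraMap _ C.K t)) ^ i ∧
      algebraMap _ C.K t ^ (i * φ.preimage D' P) * f ∈
        (algebraMap (C.Stalk P.1) C.K).range := by
    intro P t ht
    obtain ⟨t', ht'⟩ := (z' (φ.mapPoint P)).exists_span_eq_maximalIdeal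
    obtain ⟨f, rfl, hf⟩ := hω.2 (φ.mapPoint P) t' ht'
    have h := φ.pullback_apply_of_isInverse (z' (φ.mapPoint P)) hX' hα' hα
    have hs0 := φ.pullback_param_ne_zero (z' _) ht'
    have h1 := φ.param_ratio_mem (z P) (z' _) ht' ht hX (D' (φ.mapPoint P))
    have hXs : X (φ.pullback (algebraMap _ C'.K t')) ≠ 0 := by
      rw [← h]
      exact (map_ne_zero φ.pullback).2 ((z' _).apply_param_ne_zero ht' hX')
    -- Expressing φ^*α' both as ds/X(s) and as dt/X(t) yields ds = (X(s)/X(t)) dt.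
    have hD := (z P).eq_inv_smul_D_of_isInverse ht hα
    rw [(z' _).eq_inv_smul_D_of_isInverse ht' hα', pullbackDifferential_smul_D, map_inv₀, h,
      inv_smul_eq_iff₀ hXs, smul_smul, ← div_eq_mul_inv] at hD
    have hd := pullbackDifferential_smul_D φ.pullback 1 (algebraMap _ C'.K t')
    rw [one_smul, map_one, one_smul, hD] at hd
    refine ⟨φ.pullback f * (X (φ.pullback (algebraMap _ C'.K t')) / X (algebraMap _ C.K t)) ^ i,
      ?_, ?_⟩
    · rw [pullbackClassical_smul, map_pow, pullbackClassical_toDiffAlgebra, hd, map_smul, smul_pow,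
        smul_smul]
    · have h2 := φ.pullback_mem_stalkSubalgebra P hf
      obtain ⟨u, hu⟩ := mul_mem (pow_mem h1 i) h2
      refine ⟨u, hu.trans ?_⟩
      change (_ * (algebraMap _ C.K t ^ φ.preimage D' P / _)) ^ i * _ = _
      rw [map_mul, map_pow]
      exact ratio_pow_mul _ _ hs0 _ _ _ _
  refine ⟨?_, hpull⟩
  -- The local expression at any single point already exhibits a rational i-differential.
  obtain ⟨P⟩ := C.nonempty_point
  obtain ⟨t, ht⟩ := (z P).exists_span_eq_maximalIdeal
  obtain ⟨f, hf, -⟩ := hpull P t ht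
  rw [hf]
  exact Submodule.smul_mem _ _ (Submodule.pow_mem_pow _ (LinearMap.mem_range_self _ _) i)

/-- Truncation at zero discards the negative value 1 - ν, so the case without poles is an instance
of the general one. -/
theorem preimage_zero : φ.preimage 0 = 0 := by
  ext P
  change 0 * _ - _ = 0
  rw [zero_mul, Nat.zero_sub]

/-- The restriction of the pullback of operators to regular operators quantizes the classical
pullback. -/
theorem exists_quantizesPullback (z : ∀ P : C.Point, LocalCoordinate P)
    (z' : ∀ P' : C'.Point, LocalCoordinate P') (hX' : X' ≠ 0) (hX : X ≠ 0)
    {α' : Ω[C'.K⁄ℂ]} (hα' : IsInverse X' α')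
    (hα : IsInverse X (pullbackDifferential φ.pullback α'))
    (h : ∀ f, φ.pullback (X' f) = X (φ.pullback f)) (D' : EffectiveDivisor C') :
    ∃ f : BReg z' hX' D' →ₐ[ℂ] BReg z hX (φ.preimage D'),
      (∀ b, (f b : BRat C X) = PsiDO.map φ.pullback h b) ∧
      IsCompleteFilteredMorphism (inducedFiltration (BReg z' hX' D'))
        (inducedFiltration (BReg z hX (φ.preimage D'))) f ∧
      QuantizesPullback φ α' f (C'.regDifferentials D')
        (C.regDifferentials (φ.preimage D')) := by
  refine ⟨((PsiDO.map φ.pullback h).comp (BReg z' hX' D').val).codRestrict _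
    fun b => φ.map_mem_BReg z z' hX' hX h D' b.2, fun _ => rfl,
    ⟨isCompleteFiltration_inducedFiltration z' hX' D',
      isCompleteFiltration_inducedFiltration z hX _, fun n a ha j hj => ?_⟩,
    ⟨fun i b hb => principalSymbol_mem_regDifferentials z' hX' hα' D' i b hb,
      fun i b hb => principalSymbol_mem_regDifferentials z hX hα _ i b hb,
      fun i ω hω => φ.pullbackClassical_mem_regDifferentials z z' hX' hX hα' hα D' i hω,
      fun i b _ => ?_⟩⟩
  · exact (congrArg φ.pullback (ha j hj)).trans (map_zero _)
  · rw [principalSymbol, principalSymbol, pullbackClassical_smul, map_pow,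
      pullbackClassical_toDiffAlgebra]
    rfl

end Covering

end ComplexCurve

/-! ### The pullback morphism and its restrictions. -/

open ComplexCurve in
theorem mainTheorem4 {C C' : ComplexCurve} (φ : Covering C C')
    (z : ∀ P : C.Point, LocalCoordinate P) (z' : ∀ P' : C'.Point, LocalCoordinate P')
    (X' : Derivation ℂ C'.K C'.K) (hX' : X' ≠ 0)
    (α' : Ω[C'.K⁄ℂ]) (hα' : IsInverse X' α')
    (X : Derivation ℂ C.K C.K) (hX : X ≠ 0)
    (hα : IsInverse X (pullbackDifferential φ.pullback α')) :
    ∃ F : BRat C' X' →ₐ[ℂ] BRat C X,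
      (∀ b j, (F b).coeff j = φ.pullback (b.coeff j)) ∧
      IsCompleteFilteredMorphism (PsiDO.filtration X') (PsiDO.filtration X) F ∧
      (∃ f : BReg z' hX' 0 →ₐ[ℂ] BReg z hX 0,
        (∀ b, (f b : BRat C X) = F b) ∧
        IsCompleteFilteredMorphism (inducedFiltration (BReg z' hX' 0))
          (inducedFiltration (BReg z hX 0)) f ∧
        QuantizesPullback φ α' f (C'.regDifferentials 0) (C.regDifferentials 0)) ∧
      ∀ D' : EffectiveDivisor C', ∃ f : BReg z' hX' D' →ₐ[ℂ] BReg z hX (φ.preimage D'),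
        (∀ b, (f b : BRat C X) = F b) ∧
        IsCompleteFilteredMorphism (inducedFiltration (BReg z' hX' D'))
          (inducedFiltration (BReg z hX (φ.preimage D'))) f ∧
        QuantizesPullback φ α' f (C'.regDifferentials D')
          (C.regDifferentials (φ.preimage D')) := by
  obtain ⟨P'⟩ := C'.nonempty_point
  have h := φ.pullback_apply_of_isInverse (z' P') hX' hα' hα
  have H := φ.exists_quantizesPullback z z' hX' hX hα' hα h
  refine ⟨PsiDO.map φ.pullback h, fun _ _ => rfl,
    ⟨PsiDO.isCompleteFiltration_filtration X', PsiDO.isCompleteFiltration_filtration X,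
      fun n a ha j hj => (congrArg φ.pullback (ha j hj)).trans (map_zero _)⟩, ?_, H⟩
  have H0 := H 0
  rw [φ.preimage_zero] at H0
  exact H0
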